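/- **Conventions.** Banach spaces are complex. A class $\mathcal E$ of Banach spaces is *of type $>1$* if there are $p>1$ and $T\ge 0$ such that for all $E\in\mathcal E$, $n\ge 1$ and $x_1,\dots,x_n\in E$, $$\Big(\mathbb E_{\epsilon_i=\pm1}\Big\|\sum_{i=1}^n\epsilon_i x_i\Big\|^2\Big)^{1/2}\le T\Big(\sum_{i=1}^n\|x_i\|^p\Big)^{1/p}.$$ It is *stable under duality* (resp. *complex conjugation*) if $E\in\mathcal E$ implies $E^*\in\mathcal E$ (resp. $\overline E\in\mathcal E$). Let $G$ be a locally compact (Hausdorff) group with left Haar measure $dg$. A *length* on $G$ is a continuous function $\ell:G\to[0,\infty)$ with $\ell(g^{-1})=\ell(g)$ and $\ell(g_1g_2)\le\ell(g_1)+\ell(g_2)$. Let $\mathcal E_{G,\ell}$ be the class of strongly continuous representations $(E,\pi)$ of $G$ with $E\in\mathcal E$ and $\|\pi(g)\|\le e^{\ell(g)}$ for all $g\in G$. Let $\mathcal C^{\mathcal E}_\ell(G)$ be the (separated) completion of the convolution algebra $C_c(G)$ for the norm $\|f\|=\sup_{(E,\pi)\in\mathcal E_{G,\ell}}\|\pi(f)\|$,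 where $\pi(f)=\int_G f(g)\pi(g)\,dg$; each $\pi$ extends to it. An element $p$ of $\mathcal C^{\mathcal E}_\ell(G)$ is *real* (resp. *self-adjoint*) if $(p,p)$ lies in the closure of the graph of the operation $f\mapsto\bar f$ (resp. $f\mapsto f^*$) of $C_c(G)$, where $f^*$ is determined by $f^*(g)\,dg$ being the image of $\overline{f(g)}\,dg$ under $g\mapsto g^{-1}$; where the operation extends continuously to $\mathcal C^{\mathcal E}_\ell(G)$, this says that $p$ is fixed by the extension. $G$ has *strong Banach property (T)* if for every class $\mathcal E$ of type $>1$ that is stable under duality and complex conjugation, and every length $\ell$ on $G$, there is $s_0>0$ such that for all $C\ge0$ and $0<s\le s_0$ there is a real and self-adjoint idempotent $p\in\mathcal C^{\mathcal E}_{C+s\ell}(G)$ such that for every $(E,\pi)\in\mathcal E_{G,C+s\ell}$ the image of $\pi(p)$ is exactly the subspace of $G$-invariant vectors of $E$. **Proposition 5.5.** Let $G$ be a locally compact group and $\Gamma$ a discrete cocompact subgroup of $G$. If $G$ has strong Banach property (T), then so does $\Gamma$. -/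

import Mathlib

open MeasureTheory Topology
open scoped NNReal ENNReal BigOperators CompactlySupported

/-! ### Classes of complex Banach spaces -/

/-- A complex Banach space, with its norm. -/
structure BanachSp.{v} : Type (v + 1) where
  carrier : Type v
  [normedAddCommGroup : NormedAddCommGroup carrier]
  [normedSpace : NormedSpace ℂ carrier]
  [completeSpace : CompleteSpace carrier]

namespace BanachSp

instance : CoeSort BanachSp (Type _) := ⟨carrier⟩

attribute [instance] normedAddCommGroup normedSpace completeSpace

end BanachSp

/-- The complex conjugate of `E`: the same normed group, with `c` acting as its conjugate. -/
def ConjSpace (E : Type*) : Type _ := E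

namespace ConjSpace

variable (E : Type*)

instance [h : NormedAddCommGroup E] : NormedAddCommGroup (ConjSpace E) := h

instance [NormedAddCommGroup E] [h : CompleteSpace E] : CompleteSpace (ConjSpace E) := h

instance [NormedAddCommGroup E] [NormedSpace ℂ E] : Module ℂ (ConjSpace E) :=
  Module.compHom E (starRingEnd ℂ)

instance [NormedAddCommGroup E] [NormedSpace ℂ E] : NormedSpace ℂ (ConjSpace E) where
  norm_smul_le c x := by
    have h : ‖((starRingEnd ℂ c) • (show E from x) : E)‖ ≤ ‖c‖ * ‖(show E from x)‖ := by
      rw [norm_smul, RCLike.norm_conj]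
    exact h

end ConjSpace

namespace BanachSp

/-- The Banach space dual, with the operator norm. -/
noncomputable def dual (E : BanachSp) : BanachSp where
  carrier := StrongDual ℂ E

/-- The complex conjugate Banach space. -/
noncomputable def conj (E : BanachSp) : BanachSp where
  carrier := ConjSpace E

end BanachSp

/-- A class of Banach spaces is (uniformly) of type `> 1` if there are `p > 1` and `T ≥ 0` with
`(𝔼_ε ‖∑ ε i • x i‖ ^ 2) ^ (1/2) ≤ T * (∑ ‖x i‖ ^ p) ^ (1/p)` for every `E` in the class and every
finite sequence in `E`; the signs `ε` are uniformly distributed. -/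
def IsOfTypeGTOne.{v} (𝓔 : Set BanachSp.{v}) : Prop :=
  ∃ p : ℝ, 1 < p ∧ ∃ T : ℝ, 0 ≤ T ∧ ∀ E ∈ 𝓔, ∀ (n : ℕ) (x : Fin n → E),
    Real.sqrt (𝔼 ε : Fin n → ℤˣ, ‖∑ i, ((ε i : ℤ) : ℂ) • x i‖ ^ 2) ≤
      T * (∑ i, ‖x i‖ ^ p) ^ (1 / p)

def StableUnderDuality.{v} (𝓔 : Set BanachSp.{v}) : Prop := ∀ E ∈ 𝓔, E.dual ∈ 𝓔

def StableUnderConj.{v} (𝓔 : Set BanachSp.{v}) : Prop := ∀ E ∈ 𝓔, E.conj ∈ 𝓔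

/-! ### Lengths and representations -/

/-- A length on a topological group. -/
structure GroupLength (G : Type*) [Group G] [TopologicalSpace G] where
  toFun : G → ℝ≥0
  continuous_toFun : Continuous toFun
  map_inv : ∀ g, toFun g⁻¹ = toFun g
  map_mul_le : ∀ g h, toFun (g * h) ≤ toFun g + toFun h

namespace GroupLength

variable {G : Type*} [Group G] [TopologicalSpace G]

instance : CoeFun (GroupLength G) (fun _ => G → ℝ≥0) := ⟨toFun⟩

/-- The length `C + s ℓ`. -/
def affine (C s : ℝ≥0) (ℓ : GroupLength G) : GroupLength G where
  toFun g := C + s * ℓ g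
  continuous_toFun := continuous_const.add (continuous_const.mul ℓ.continuous_toFun)
  map_inv g := by rw [ℓ.map_inv]
  map_mul_le g h := by
    have h1 : s * ℓ (g * h) ≤ s * ℓ g + s * ℓ h := by
      rw [← mul_add]; exact mul_le_mul_right (ℓ.map_mul_le g h) s
    calc C + s * ℓ (g * h) ≤ C + (s * ℓ g + s * ℓ h) := by gcongr
      _ ≤ (C + s * ℓ g) + (C + s * ℓ h) := by
        rw [← NNReal.coe_le_coe]; push_cast
        have : (0 : ℝ) ≤ C := C.2
        linarith

end GroupLength

/-- The (strongly) continuous representations `(E, π)` of `G` on spaces `E` of the class `𝓔` such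
that `‖π g‖ ≤ exp (ℓ g)` for all `g`. -/
structure BanachRep.{u, v} {G : Type u} [Group G] [TopologicalSpace G] (𝓔 : Set BanachSp.{v})
    (ℓ : GroupLength G) : Type (max u (v + 1)) where
  E : BanachSp.{v}
  mem : E ∈ 𝓔
  π : G →* (E →L[ℂ] E)
  continuous_orbit : ∀ x : E, Continuous fun g => π g x
  norm_le : ∀ g, ‖π g‖ ≤ Real.exp (ℓ g)

section Algebra

universe u v

variable {G : Type u} [Group G] [TopologicalSpace G] [IsTopologicalGroup G]
  [LocallyCompactSpace G] [MeasurableSpace G] [BorelSpace G]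
  {𝓔 : Set BanachSp.{v}} {ℓ : GroupLength G}

namespace BanachRep

theorem integrable_smul (r : BanachRep 𝓔 ℓ) (f : C_c(G, ℂ)) (x : r.E) :
    Integrable (fun g => f g • r.π g x) (Measure.haar : Measure G) := by
  refine Continuous.integrable_of_hasCompactSupport ?_ ?_
  · exact (map_continuous f).smul (r.continuous_orbit x)
  · exact HasCompactSupport.smul_right f.hasCompactSupport

/-- A bound for the norm of `π(f)` which does not depend on the representation. -/
noncomputable def bound (ℓ : GroupLength G) (f : C_c(G, ℂ)) : ℝ :=
  ∫ g, ‖f g‖ * Real.exp (ℓ g) ∂(Measure.haar : Measure G)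

theorem bound_nonneg (f : C_c(G, ℂ)) : 0 ≤ bound ℓ f :=
  integral_nonneg fun _ => by positivity

theorem norm_integral_le (r : BanachRep 𝓔 ℓ) (f : C_c(G, ℂ)) (x : r.E) :
    ‖∫ g, f g • r.π g x ∂(Measure.haar : Measure G)‖ ≤ bound ℓ f * ‖x‖ := by
  rw [bound, ← integral_mul_const]
  refine norm_integral_le_of_norm_le ?_ (Filter.Eventually.of_forall fun g => ?_)
  · refine Integrable.mul_const (Continuous.integrable_of_hasCompactSupport ?_ ?_) _
    · exact (map_continuous f).norm.mul
        (Real.continuous_exp.comp (NNReal.continuous_coe.comp ℓ.continuous_toFun))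
    · exact HasCompactSupport.mul_right f.hasCompactSupport.norm
  · rw [norm_smul, mul_assoc]
    exact mul_le_mul_of_nonneg_left
      (((r.π g).le_opNorm x).trans (mul_le_mul_of_nonneg_right (r.norm_le g) (norm_nonneg x)))
      (norm_nonneg _)

/-- The operator `π(f) = ∫ f(g) π(g) dg` for `f ∈ C_c(G)`, where `dg` is a left Haar measure. -/
noncomputable def integrated (r : BanachRep 𝓔 ℓ) (f : C_c(G, ℂ)) : r.E →L[ℂ] r.E :=
  LinearMap.mkContinuous
    { toFun := fun x => ∫ g, f g • r.π g x ∂(Measure.haar : Measure G)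
      map_add' := fun x y => by
        rw [← integral_add (r.integrable_smul f x) (r.integrable_smul f y)]
        simp
      map_smul' := fun c x => by
        rw [RingHom.id_apply, ← integral_smul]
        congr 1; ext g
        rw [map_smul, smul_comm] }
    (bound ℓ f) (r.norm_integral_le f)

theorem integrated_apply (r : BanachRep 𝓔 ℓ) (f : C_c(G, ℂ)) (x : r.E) :
    r.integrated f x = ∫ g, f g • r.π g x ∂(Measure.haar : Measure G) := rfl

theorem norm_integrated_le (r : BanachRep 𝓔 ℓ) (f : C_c(G, ℂ)) :
    ‖r.integrated f‖ ≤ bound ℓ f :=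
  LinearMap.mkContinuous_norm_le _ (bound_nonneg f) _

end BanachRep

variable (𝓔 ℓ)

/-- The Banach algebra of all norm-bounded families of operators `T r : E →L[ℂ] E`, indexed by the
representations `r = (E, π)` in the class, with the supremum norm and componentwise product. -/
abbrev BoundedFamilies : Type _ := lp (fun r : BanachRep 𝓔 ℓ => r.E →L[ℂ] r.E) ∞

/-- The map `f ↦ (π(f))_{(E, π)}` on `C_c(G)`. -/
noncomputable def integratedFamily : C_c(G, ℂ) →ₗ[ℂ] BoundedFamilies 𝓔 ℓ where
  toFun f := ⟨fun r => r.integrated f, memℓp_infty ⟨BanachRep.bound ℓ f, by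
    rintro _ ⟨r, rfl⟩
    exact r.norm_integrated_le f⟩⟩
  map_add' f g := by
    ext r x
    have h := integral_add (r.integrable_smul f x) (r.integrable_smul g x)
    simp only [← add_smul] at h
    exact h
  map_smul' c f := by
    ext r x
    have h := integral_smul (μ := (Measure.haar : Measure G)) c (fun g => f g • r.π g x)
    simp only [← mul_smul] at h
    exact h

/-- The norm on `C_c(G)` that is induced by `integratedFamily` is `sup ‖π(f)‖`, the supremum being
taken over all representations in the class. -/
theorem norm_integratedFamily (f : C_c(G, ℂ)) :
    ‖integratedFamily 𝓔 ℓ f‖ = ⨆ r : BanachRep 𝓔 ℓ, ‖r.integrated f‖ :=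
  lp.norm_eq_ciSup _

/-- The Banach algebra `C_ℓ^𝓔(G)`, the (separated) completion of the convolution algebra `C_c(G)`
for the norm `sup ‖π(f)‖`: it is realized as the closure of the image of `C_c(G)` in the Banach
algebra of bounded families, the image of `C_c(G)` carrying exactly this norm. The product is the
componentwise one, which on `C_c(G)` is convolution because `π(f₁ * f₂) = π(f₁) π(f₂)`. For
`p` in it, the operator `π(p)` is the component of `p` at `(E, π)`. -/
noncomputable def completedAlgebra : Submodule ℂ (BoundedFamilies 𝓔 ℓ) :=
  (LinearMap.range (integratedFamily 𝓔 ℓ)).topologicalClosure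

variable {𝓔 ℓ}

/-- `f'` is the image of `f` under the involution `∫ f(g) e_g dg ↦ ∫ conj (f(g)) e_{g⁻¹} dg` of
`C_c(G)`, that is, the measure `f'(g) dg` is the image of `conj (f(g)) dg` under `g ↦ g⁻¹`. (So
`f'(g) = Δ(g)⁻¹ conj (f(g⁻¹))` with the modular function `Δ`, where `μ(A g) = Δ(g) μ(A)`.) -/
def IsInvolutionOf (f f' : C_c(G, ℂ)) : Prop :=
  ∀ φ : C(G, ℂ), ∫ g, f' g * φ g ∂(Measure.haar : Measure G) =
    ∫ g, (starRingEnd ℂ) (f g) * φ g⁻¹ ∂(Measure.haar : Measure G)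

/-- `p` is real, i.e. equal to its complex conjugate: `(p, p)` lies in the closure of the graph of
`f ↦ conj ∘ f` on `C_c(G)` (here `star f` is the pointwise complex conjugate of `f`). -/
def IsRealElement (p : BoundedFamilies 𝓔 ℓ) : Prop :=
  (p, p) ∈ closure {q : BoundedFamilies 𝓔 ℓ × BoundedFamilies 𝓔 ℓ |
    ∃ f : C_c(G, ℂ), q = (integratedFamily 𝓔 ℓ f, integratedFamily 𝓔 ℓ (star f))}

/-- `p` is self-adjoint, i.e. equal to its image under the usual involution: `(p, p)` lies in the
closure of the graph of the involution of `C_c(G)`. -/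
def IsSelfAdjointElement (p : BoundedFamilies 𝓔 ℓ) : Prop :=
  (p, p) ∈ closure {q : BoundedFamilies 𝓔 ℓ × BoundedFamilies 𝓔 ℓ |
    ∃ f f' : C_c(G, ℂ), IsInvolutionOf f f' ∧
      q = (integratedFamily 𝓔 ℓ f, integratedFamily 𝓔 ℓ f')}

end Algebra

/-- Strong Banach property (T), for classes of Banach spaces in the universe `v`. -/
def StrongBanachPropertyT.{u, v} (G : Type u) [Group G] [TopologicalSpace G]
    [IsTopologicalGroup G] [LocallyCompactSpace G] [MeasurableSpace G] [BorelSpace G] : Prop :=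
  ∀ 𝓔 : Set BanachSp.{v}, IsOfTypeGTOne 𝓔 → StableUnderDuality 𝓔 → StableUnderConj 𝓔 →
    ∀ ℓ : GroupLength G, ∃ s₀ : ℝ≥0, 0 < s₀ ∧ ∀ C s : ℝ≥0, 0 < s → s ≤ s₀ →
      ∃ p ∈ completedAlgebra 𝓔 (ℓ.affine C s),
        IsIdempotentElem p ∧ IsRealElement p ∧ IsSelfAdjointElement p ∧
          ∀ r : BanachRep 𝓔 (ℓ.affine C s),
            Set.range (p r : r.E →L[ℂ] r.E) = {x : r.E | ∀ g : G, r.π g x = x}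

universe u v

/-!
The idempotent for `Γ` is obtained from the one for `G` by inducing representations from `Γ` to `G`
and compressing back.

Cocompactness provides a cutoff function `α ∈ C_c(G)`, `α ≥ 0`, whose translates by `Γ` sum to `1`.
It serves as a weighted fundamental domain: `∫_G u = ∫_G α(h) ∑_γ u(h γ) dh`, for a right invariant
measure; it follows that `G` is unimodular (`CutoffFunction.isMulRightInvariant_haar`).

*Induction.* For a representation `(E, π)` of `Γ`, `G` acts by left translations on the continuous
maps `f : G → E` with `f(h γ) = π(γ)⁻¹ f(h)`, completed for the norm `(∫ α(h) ‖f(h)‖² dh)^(1/2)`.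
If `‖π(γ)‖ ≤ exp (m γ)`, then `g` acts with norm at most `exp (m' g)` as soon as `m γ ≤ m' g`
whenever `y` and `g y γ` lie in the support of `α`. If `m = C + s ℓ`, one can take
`m' = C + s b + s ℓ'`, where `ℓ'(g)` is the supremum over `y` of `|v(g y) - v(y)|` for the smoothing
`v(y) = ∑_γ α(y γ) ℓ(γ)` of `ℓ`, and `b` is a constant (`CutoffFunction.exists_le_inducedLength`).
As `b` only changes the additive constant, the threshold `s₀` of `ℓ'` for `G` works for `ℓ`.

*Classes of Banach spaces.* A class of type `> 1` that is stable under duality lies in the class of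
all `E` such that `E` and `E*` have type `q` with constant `T`, for suitable `q ∈ (1, 2]` and `T`.
Type `q` of `E` bounds the matrix of signs as an operator `ℓ^q(E) → ℓ²(E)`, and type `q` of `E*`
bounds the transposed matrix as an operator `ℓ²(E) → ℓ^q'(E)`. Stated in this way, both conditions
visibly pass to (pre)duals and conjugates (`MatrixBound.transpose`), and by Minkowski's inequality
they pass from `E` to the induced space with the same constants, because `q ≤ 2 ≤ q'`
(`MatrixBound.preInduced`).

*Compression.* There are maps `E → Ind E`, `x ↦ (h ↦ ∑_γ α(h γ) π(γ) x)`, and `Ind E → E`,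
`f ↦ ∫ α(h) f(h) dh`. Composing an operator on `Ind E` with them and dividing by `∫ α` sends the
operator of `f ∈ C_c(G)` to the operator of a function `compressFun α f ∈ C_c(Γ)`
(`compress_eq_integral`). So it defines a continuous map `transfer` from the algebra of `G` to that
of `Γ`. It preserves real elements since `α` is real, and self-adjoint ones since `G` is unimodular.

Let `p` be the idempotent for `G`. The image of `p` in `Ind E` consists of the `G`-invariant
vectors, and `∫ β(h) f(h) dh` is `Γ`-invariant for every such `f` and `β ∈ C_c(G)`: applying `π(γ)`
amounts to translating `β`, and on an invariant `f` the average only depends on `∫ β`, by a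
regularization argument as in the uniqueness of the Haar measure
(`averageInduced_eq_of_integral_eq`). This argument is needed because the elements of the completion
are not functions. Conversely a `Γ`-invariant vector is sent to an invariant constant function and
back to itself. Hence the transfer of `p` maps `E` into the `Γ`-invariant vectors and fixes these,
so that it is an idempotent with the required image, although `transfer` is not multiplicative.
-/

/-! ### Cutoff functions of a discrete cocompact subgroup -/

section Cutoff

variable {G : Type*} [Group G] [TopologicalSpace G]

open scoped Pointwise in
theorem Subgroup.finite_setOf_mul_mem [IsTopologicalGroup G] [T2Space G] (Γ : Subgroup G)
    [DiscreteTopology Γ] {Q₁ Q₂ : Set G} (h₁ : IsCompact Q₁) (h₂ : IsCompact Q₂) :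
    {γ : Γ | ∃ h ∈ Q₁, h * (γ : G) ∈ Q₂}.Finite := by
  have hc : IsClosed (Γ : Set G) := Subgroup.isClosed_of_discrete
  have hK : IsCompact (Q₁⁻¹ * Q₂) := h₁.inv.mul h₂
  have : IsCompact ((↑) ⁻¹' (Q₁⁻¹ * Q₂) : Set Γ) :=
    hc.isClosedEmbedding_subtypeVal.isCompact_preimage hK
  refine this.finite_of_discrete.subset ?_
  rintro γ ⟨h, hh, hγ⟩
  exact ⟨h⁻¹, Set.inv_mem_inv.2 hh, h * γ, hγ, by simp⟩

/-- A compact set meets every coset of a cocompact subgroup. -/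
theorem exists_isCompact_forall_exists_mul_mem [IsTopologicalGroup G]
    (Γ : Subgroup G) [LocallyCompactSpace G] [CompactSpace (G ⧸ Γ)] :
    ∃ K : Set G, IsCompact K ∧ ∀ g : G, ∃ γ : Γ, g * γ ∈ K := by
  obtain ⟨t, ht⟩ : ∃ t : Finset G, (⋃ x ∈ t, (QuotientGroup.mk '' interior
      (Classical.choose (exists_compact_mem_nhds x)) : Set (G ⧸ Γ))) = Set.univ := by
    have hopen : ∀ x : G, IsOpen (QuotientGroup.mk '' interior
        (Classical.choose (exists_compact_mem_nhds x)) : Set (G ⧸ Γ)) := fun x =>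
      QuotientGroup.isOpenMap_coe _ isOpen_interior
    obtain ⟨t, ht⟩ := isCompact_univ.elim_finite_subcover _ hopen (by
      intro y _
      obtain ⟨x, rfl⟩ := QuotientGroup.mk_surjective y
      exact Set.mem_iUnion.2 ⟨x, x, mem_interior_iff_mem_nhds.2
        (Classical.choose_spec (exists_compact_mem_nhds x)).2, rfl⟩)
    exact ⟨t, Set.univ_subset_iff.1 ht⟩
  refine ⟨⋃ x ∈ t, Classical.choose (exists_compact_mem_nhds x),
    t.isCompact_biUnion fun x _ => (Classical.choose_spec (exists_compact_mem_nhds x)).1, ?_⟩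
  intro g
  have : (QuotientGroup.mk g : G ⧸ Γ) ∈ ⋃ x ∈ t, (QuotientGroup.mk '' interior
      (Classical.choose (exists_compact_mem_nhds x)) : Set (G ⧸ Γ)) := by rw [ht]; trivial
  simp only [Set.mem_iUnion] at this
  obtain ⟨x, hx, y, hy, hyg⟩ := this
  have hΓ : g⁻¹ * y ∈ Γ := QuotientGroup.eq.1 hyg.symm
  refine ⟨⟨g⁻¹ * y, hΓ⟩, ?_⟩
  simp only [mul_inv_cancel_left, Set.mem_iUnion]
  exact ⟨x, hx, interior_subset hy⟩

/-- A cutoff function for the right action of a subgroup `Γ` on `G`: a nonnegative continuous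
function with compact support whose `Γ`-translates sum to `1`. -/
structure CutoffFunction (Γ : Subgroup G) where
  toFun : G → ℝ
  continuous_toFun : Continuous toFun
  hasCompactSupport : HasCompactSupport toFun
  nonneg : ∀ h, 0 ≤ toFun h
  finsum_eq_one : ∀ h, ∑ᶠ γ : Γ, toFun (h * γ) = 1

namespace CutoffFunction

variable {Γ : Subgroup G}

instance : CoeFun (CutoffFunction Γ) (fun _ => G → ℝ) := ⟨toFun⟩

/-- The support of a cutoff function. -/
def supp (α : CutoffFunction Γ) : Set G := tsupport α

theorem isCompact_supp (α : CutoffFunction Γ) : IsCompact α.supp := α.hasCompactSupport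

theorem mem_supp (α : CutoffFunction Γ) {h : G} (hh : α h ≠ 0) : h ∈ α.supp :=
  subset_tsupport _ hh

theorem exists_ne_zero (α : CutoffFunction Γ) : ∃ h, α h ≠ 0 := by
  by_contra! H
  simpa [H] using α.finsum_eq_one 1

end CutoffFunction

section

variable [IsTopologicalGroup G] [T2Space G] (Γ : Subgroup G) [DiscreteTopology Γ]

theorem finite_support_of_mul_mem {M : Type*} [Zero M] {Q : Set G} (hQ : IsCompact Q)
    {F : Γ → M} (h : G) (hF : ∀ γ, F γ ≠ 0 → h * (γ : G) ∈ Q) : (Function.support F).Finite :=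
  (Γ.finite_setOf_mul_mem (isCompact_singleton (x := h)) hQ).subset
    fun γ hγ => ⟨h, rfl, hF γ hγ⟩

/-- A sum over `Γ` whose terms are supported on the translates of a compact set is locally
finite. -/
theorem continuous_finsum_of_mul_mem [LocallyCompactSpace G] {M : Type*} [TopologicalSpace M]
    [AddCommMonoid M] [ContinuousAdd M] {Q : Set G} (hQ : IsCompact Q) {F : Γ → G → M}
    (hFc : ∀ γ, Continuous (F γ)) (hF : ∀ γ h, F γ h ≠ 0 → h * (γ : G) ∈ Q) :
    Continuous fun h => ∑ᶠ γ, F γ h := by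
  refine continuous_finsum hFc fun h => ?_
  obtain ⟨N, hN, hNh⟩ := exists_compact_mem_nhds h
  refine ⟨N, hNh, (Γ.finite_setOf_mul_mem hN hQ).subset ?_⟩
  rintro γ ⟨x, hx, hxN⟩
  exact ⟨x, hxN, hF γ x hx⟩

/-- Normalize a compactly supported function which is `1` on a compact set meeting every coset. -/
theorem exists_cutoffFunction [LocallyCompactSpace G] [CompactSpace (G ⧸ Γ)] :
    Nonempty (CutoffFunction Γ) := by
  obtain ⟨K, hK, hKΓ⟩ := exists_isCompact_forall_exists_mul_mem Γ
  obtain ⟨f, hf1, -, hfc, hf01⟩ :=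
    exists_continuous_one_zero_of_isCompact hK isClosed_empty (Set.disjoint_empty K)
  have hmem : ∀ (γ : Γ) h, f (h * γ) ≠ 0 → h * (γ : G) ∈ tsupport f :=
    fun γ h hh => subset_tsupport _ hh
  have hWc : Continuous fun h => ∑ᶠ γ : Γ, f (h * γ) :=
    continuous_finsum_of_mul_mem Γ hfc (fun γ => by fun_prop) hmem
  have hWpos : ∀ h, 0 < ∑ᶠ γ : Γ, f (h * γ) := by
    intro h
    obtain ⟨γ, hγ⟩ := hKΓ h
    exact finsum_pos (fun δ => (hf01 _).1) ⟨γ, by rw [hf1 hγ]; exact one_pos⟩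
      (finite_support_of_mul_mem Γ hfc h (fun γ => hmem γ h))
  refine ⟨⟨fun h => f h * (∑ᶠ γ : Γ, f (h * γ))⁻¹, ?_, ?_, ?_, ?_⟩⟩
  · exact f.continuous.mul (hWc.inv₀ fun h => (hWpos h).ne')
  · exact HasCompactSupport.mul_right hfc
  · exact fun h => mul_nonneg (hf01 h).1 (inv_nonneg.2 (hWpos h).le)
  · intro h
    have hinv : ∀ γ : Γ, ∑ᶠ δ : Γ, f (h * γ * δ) = ∑ᶠ δ : Γ, f (h * δ) := by
      intro γ
      have := finsum_comp_equiv (Equiv.mulLeft γ) (f := fun δ : Γ => f (h * δ))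
      simpa [mul_assoc] using this
    simp only [hinv]
    rw [← finsum_mul' _ _ (finite_support_of_mul_mem Γ hfc h fun γ => hmem γ h)]
    exact mul_inv_cancel₀ (hWpos h).ne'

end

namespace CutoffFunction

variable [IsTopologicalGroup G] [T2Space G] {Γ : Subgroup G} [DiscreteTopology Γ]

/-- The finite set of all `γ ∈ Γ` that move a point of `Q` into the support of `α`. -/
noncomputable def translates (α : CutoffFunction Γ) {Q : Set G} (hQ : IsCompact Q) : Finset Γ :=
  (Γ.finite_setOf_mul_mem hQ α.isCompact_supp).toFinset

theorem mem_translates (α : CutoffFunction Γ) {Q : Set G} (hQ : IsCompact Q) {h : G} (hh : h ∈ Q)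
    {γ : Γ} (hγ : α (h * γ) ≠ 0) : γ ∈ α.translates hQ := by
  rw [translates, Set.Finite.mem_toFinset]
  exact ⟨h, hh, α.mem_supp hγ⟩

theorem sum_translates (α : CutoffFunction Γ) {Q : Set G} (hQ : IsCompact Q) {h : G}
    (hh : h ∈ Q) : ∑ γ ∈ α.translates hQ, α (h * γ) = 1 := by
  rw [← α.finsum_eq_one h]
  exact (finsum_eq_sum_of_support_subset _ fun γ hγ => α.mem_translates hQ hh hγ).symm

theorem finite_support (α : CutoffFunction Γ) (h : G) :
    (Function.support fun γ : Γ => α (h * γ)).Finite :=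
  finite_support_of_mul_mem Γ α.isCompact_supp h fun _ hγ => α.mem_supp hγ

end CutoffFunction

end Cutoff

/-! ### Unfolding of integrals and unimodularity -/

section Unfolding

theorem CutoffFunction.integral_pos {G : Type*} [Group G] [TopologicalSpace G]
    [MeasurableSpace G] [OpensMeasurableSpace G] {Γ : Subgroup G} (α : CutoffFunction Γ)
    (μ : Measure G) [IsFiniteMeasureOnCompacts μ] [μ.IsOpenPosMeasure] : 0 < ∫ h, α h ∂μ :=
  let ⟨_, hh⟩ := α.exists_ne_zero
  α.continuous_toFun.integral_pos_of_hasCompactSupport_nonneg_nonzero α.hasCompactSupport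
    α.nonneg hh

variable {G : Type*} [Group G] [TopologicalSpace G] [IsTopologicalGroup G] [T2Space G]
  [MeasurableSpace G] [BorelSpace G] {Γ : Subgroup G} [DiscreteTopology Γ]

/-- Unfolding: an integral over `G` is an integral over a fundamental domain (in the weighted sense
of the cutoff function `α`) of the sum over the `Γ`-orbits. -/
theorem CutoffFunction.integral_eq_integral_mul_finsum (α : CutoffFunction Γ) (μ : Measure G)
    [IsFiniteMeasureOnCompacts μ] [μ.IsMulRightInvariant] {u : G → ℝ} (hu : Continuous u)
    (huc : HasCompactSupport u) :
    ∫ h, u h ∂μ = ∫ h, α h * ∑ᶠ γ : Γ, u (h * γ) ∂μ := by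
  have hQ : IsCompact (tsupport u) := huc
  set S := α.translates hQ with hS
  have h1 : ∀ h, u h = ∑ γ ∈ S, u h * α (h * γ) := by
    intro h
    by_cases hh : u h = 0
    · simp [hh]
    · rw [← Finset.mul_sum, α.sum_translates hQ (subset_tsupport _ hh), mul_one]
  have h2 : ∀ h, α h * ∑ᶠ γ : Γ, u (h * γ) = ∑ γ ∈ S, u (h * (γ : G)⁻¹) * α h := by
    intro h
    by_cases hh : α h = 0
    · simp [hh]
    · rw [← Finset.sum_mul, mul_comm]
      congr 1
      rw [← finsum_comp_equiv (Equiv.inv Γ)]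
      refine finsum_eq_sum_of_support_subset _ fun γ hγ => ?_
      have hγ' : u (h * (γ : G)⁻¹) ≠ 0 := by simpa using hγ
      refine α.mem_translates hQ (subset_tsupport _ hγ') ?_
      simpa using hh
  calc ∫ h, u h ∂μ = ∫ h, ∑ γ ∈ S, u h * α (h * γ) ∂μ := by simp_rw [← h1]
    _ = ∑ γ ∈ S, ∫ h, u h * α (h * γ) ∂μ := by
      refine integral_finsetSum _ fun γ _ => Continuous.integrable_of_hasCompactSupport ?_ ?_
      · exact hu.mul (α.continuous_toFun.comp (by fun_prop))
      · exact huc.mul_right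
    _ = ∑ γ ∈ S, ∫ h, u (h * (γ : G)⁻¹) * α h ∂μ := by
      refine Finset.sum_congr rfl fun γ _ => ?_
      rw [← integral_mul_right_eq_self _ (γ : G)⁻¹]
      simp
    _ = ∫ h, ∑ γ ∈ S, u (h * (γ : G)⁻¹) * α h ∂μ := by
      refine (integral_finsetSum _ fun γ _ =>
        Continuous.integrable_of_hasCompactSupport ?_ ?_).symm
      · exact (hu.comp (by fun_prop)).mul α.continuous_toFun
      · exact α.hasCompactSupport.mul_left
    _ = _ := by simp_rw [← h2]

/-- Left translates of `α` have the same integral with respect to a *right* invariant measure: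
unfold, and use that the `Γ`-translates of `α (g * ·)` also sum to `1`. -/
theorem CutoffFunction.integral_mul_left_eq (α : CutoffFunction Γ) (μ : Measure G)
    [IsFiniteMeasureOnCompacts μ] [μ.IsMulRightInvariant] (g : G) :
    ∫ h, α (g * h) ∂μ = ∫ h, α h ∂μ := by
  rw [α.integral_eq_integral_mul_finsum μ (u := fun h => α (g * h))
    (α.continuous_toFun.comp (by fun_prop))
    (α.hasCompactSupport.comp_homeomorph (Homeomorph.mulLeft g))]
  simp_rw [← mul_assoc, α.finsum_eq_one, mul_one]

/-- A group with a discrete cocompact subgroup is unimodular: the test function `h ↦ α (h⁻¹)` has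
the same integral as its right translates, so the modular function is `1`. -/
theorem CutoffFunction.isMulRightInvariant_haar [LocallyCompactSpace G] (α : CutoffFunction Γ) :
    (Measure.haar : Measure G).IsMulRightInvariant := by
  refine ⟨fun g => ?_⟩
  set μ : Measure G := Measure.haar
  have hreg : (Measure.map (· * g) μ).Regular :=
    Measure.Regular.map (Homeomorph.mulRight g)
  have hmap := Measure.isMulLeftInvariant_eq_smul_of_regular (Measure.map (· * g) μ) μ
  set c := Measure.haarScalarFactor (Measure.map (· * g) μ) μ
  set β : G → ℝ := fun h => α h⁻¹ with hβ
  have hβc : Continuous β := α.continuous_toFun.comp continuous_inv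
  have hβs : HasCompactSupport β := α.hasCompactSupport.comp_homeomorph (Homeomorph.inv G)
  have hpos : 0 < ∫ h, β h ∂μ := by
    obtain ⟨h, hh⟩ := α.exists_ne_zero
    refine hβc.integral_pos_of_hasCompactSupport_nonneg_nonzero (x := h⁻¹) hβs
      (fun _ => α.nonneg _) (by simpa [hβ] using hh)
  have h1 : ∫ h, β (h * g) ∂μ = ∫ h, β h ∂μ := by
    have := α.integral_mul_left_eq μ.inv g⁻¹
    rw [Measure.inv, MeasureTheory.integral_map (f := fun h => α (g⁻¹ * h))
      measurable_inv.aemeasurable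
      (α.continuous_toFun.comp (continuous_const_mul _)).aestronglyMeasurable,
      MeasureTheory.integral_map measurable_inv.aemeasurable
      α.continuous_toFun.aestronglyMeasurable] at this
    simpa [hβ] using this
  have h2 : ∫ h, β (h * g) ∂μ = c * ∫ h, β h ∂μ := by
    rw [← MeasureTheory.integral_map (φ := fun h => h * g) (f := β)
      (measurable_mul_const g).aemeasurable hβc.aestronglyMeasurable, hmap,
      integral_smul_nnreal_measure]
    rfl
  have hc : (c : ℝ) = 1 := by
    rw [h1] at h2
    exact (mul_right_cancel₀ hpos.ne' (by rw [one_mul]; exact h2)).symm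
  have hc' : c = 1 := by exact_mod_cast hc
  rw [hmap, hc', one_smul]

end Unfolding

/-! ### The induced length -/

section InducedLength

variable {G : Type*} [Group G] [TopologicalSpace G] [IsTopologicalGroup G] [T2Space G]
  {Γ : Subgroup G} [DiscreteTopology Γ]

theorem CutoffFunction.exists_translate_mem_supp {G : Type*} [Group G] [TopologicalSpace G]
    {Γ : Subgroup G} (α : CutoffFunction Γ) (y : G) : ∃ γ : Γ, y * (γ : G) ∈ α.supp := by
  by_contra! H
  have h0 : ∀ γ : Γ, α (y * γ) = 0 := fun γ => by
    by_contra h; exact H γ (α.mem_supp h)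
  simpa [h0] using α.finsum_eq_one y

theorem CutoffFunction.le_one (α : CutoffFunction Γ) (y : G) : α y ≤ 1 := by
  rw [← α.finsum_eq_one y]
  simpa using single_le_finsum (1 : Γ) (α.finite_support y) fun γ => α.nonneg _

theorem GroupLength.abs_sub_le {H : Type*} [Group H] [TopologicalSpace H] (ℓ : GroupLength H)
    (a b : H) : |(ℓ (a * b) : ℝ) - ℓ a| ≤ ℓ b := by
  have h1 : (ℓ (a * b) : ℝ) ≤ ℓ a + ℓ b := by exact_mod_cast ℓ.map_mul_le a b
  have h2 : (ℓ a : ℝ) ≤ ℓ (a * b) + ℓ b := by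
    have := ℓ.map_mul_le (a * b) b⁻¹
    rw [mul_inv_cancel_right, ℓ.map_inv] at this
    exact_mod_cast this
  rw [abs_le]; constructor <;> linarith

/-- The smoothing `y ↦ ∑ α (y γ) ℓ γ` of a length on `Γ` to a function on `G`. -/
noncomputable def CutoffFunction.smoothing (α : CutoffFunction Γ) (ℓ : GroupLength Γ) (y : G) : ℝ :=
  ∑ᶠ γ : Γ, α (y * γ) * ℓ γ

open scoped Pointwise in
/-- The smoothing of a length has oscillation `|v (g y) - v y|` bounded by a finite sum which only
involves a point `k` of the support of `α`. -/
theorem CutoffFunction.exists_abs_smoothing_sub_le (α : CutoffFunction Γ) (ℓ : GroupLength Γ)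
    {N : Set G} (hN : IsCompact N) : ∃ S : Finset Γ, ∀ g ∈ N, ∀ y : G, ∃ k ∈ α.supp,
      |α.smoothing ℓ (g * y) - α.smoothing ℓ y| ≤
        ∑ γ ∈ S, |α (g * k * γ) - α (k * γ)| * ℓ γ := by
  have hQ : IsCompact (N * α.supp ∪ α.supp) :=
    (hN.mul α.isCompact_supp).union α.isCompact_supp
  refine ⟨α.translates hQ, fun g hg y => ?_⟩
  set S := α.translates hQ
  obtain ⟨γ₁, hγ₁⟩ := α.exists_translate_mem_supp y
  refine ⟨y * γ₁, hγ₁, ?_⟩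
  set k := y * (γ₁ : G) with hk
  have hsum : ∀ x : G, x * γ₁ ∈ N * α.supp ∪ α.supp →
      α.smoothing ℓ x = ∑ γ ∈ S, α (x * γ₁ * γ) * ℓ (γ₁ * γ) := by
    intro x hx
    rw [smoothing, ← finsum_comp_equiv (Equiv.mulLeft γ₁)]
    rw [finsum_eq_sum_of_support_subset (s := S)]
    · simp [mul_assoc]
    · intro γ hγ
      refine α.mem_translates hQ hx ?_
      have := left_ne_zero_of_mul (Function.mem_support.1 hγ)
      simpa [mul_assoc] using this
  have hg1 : g * y * γ₁ ∈ N * α.supp ∪ α.supp :=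
    Or.inl ⟨g, hg, k, hγ₁, by simp [hk, mul_assoc]⟩
  have hy1 : y * γ₁ ∈ N * α.supp ∪ α.supp := Or.inr hγ₁
  have e1 := α.sum_translates hQ hg1
  have e2 := α.sum_translates hQ hy1
  rw [hsum _ hg1, hsum _ hy1]
  -- as both families of weights sum to `1`, the constant `ℓ γ₁` can be subtracted from `ℓ (γ₁ γ)`
  have key : ∑ γ ∈ S, α (g * y * γ₁ * γ) * (ℓ (γ₁ * γ) : ℝ) -
      ∑ γ ∈ S, α (y * γ₁ * γ) * (ℓ (γ₁ * γ) : ℝ) =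
      ∑ γ ∈ S, (α (g * k * γ) - α (k * γ)) * ((ℓ (γ₁ * γ) : ℝ) - ℓ γ₁) := by
    simp only [sub_mul, mul_sub, Finset.sum_sub_distrib, ← Finset.sum_mul, hk, ← mul_assoc]
    rw [e1, e2]; ring
  rw [key]
  refine (Finset.abs_sum_le_sum_abs _ _).trans (Finset.sum_le_sum fun γ _ => ?_)
  rw [abs_mul]
  exact mul_le_mul_of_nonneg_left (ℓ.abs_sub_le _ _) (abs_nonneg _)

theorem CutoffFunction.bddAbove_smoothing (α : CutoffFunction Γ) (ℓ : GroupLength Γ) (g : G) :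
    BddAbove (Set.range fun y => |α.smoothing ℓ (g * y) - α.smoothing ℓ y|) := by
  obtain ⟨S, hS⟩ := α.exists_abs_smoothing_sub_le ℓ (isCompact_singleton (x := g))
  refine ⟨∑ γ ∈ S, (ℓ γ : ℝ), ?_⟩
  rintro _ ⟨y, rfl⟩
  obtain ⟨k, -, hk⟩ := hS g rfl y
  refine hk.trans (Finset.sum_le_sum fun γ _ => ?_)
  refine mul_le_of_le_one_left (NNReal.coe_nonneg _) ?_
  have := α.nonneg (g * k * γ)
  have := α.nonneg (k * γ)
  have := α.le_one (g * k * γ)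
  have := α.le_one (k * γ)
  rw [abs_le]; constructor <;> linarith

/-- The oscillation `sup |v (g y) - v y|` of the smoothing `v` of `ℓ`, as a function of `g`; the
supremum is finite by `bddAbove_smoothing`. -/
noncomputable def CutoffFunction.oscillation (α : CutoffFunction Γ) (ℓ : GroupLength Γ) (g : G) :
    ℝ := ⨆ y, |α.smoothing ℓ (g * y) - α.smoothing ℓ y|

namespace CutoffFunction

theorem le_oscillation (α : CutoffFunction Γ) (ℓ : GroupLength Γ) (g y : G) :
    |α.smoothing ℓ (g * y) - α.smoothing ℓ y| ≤ α.oscillation ℓ g :=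
  le_ciSup (α.bddAbove_smoothing ℓ g) y

theorem oscillation_nonneg (α : CutoffFunction Γ) (ℓ : GroupLength Γ) (g : G) :
    0 ≤ α.oscillation ℓ g := (abs_nonneg _).trans (α.le_oscillation ℓ g 1)

theorem oscillation_inv_le (α : CutoffFunction Γ) (ℓ : GroupLength Γ) (g : G) :
    α.oscillation ℓ g⁻¹ ≤ α.oscillation ℓ g := by
  refine ciSup_le fun y => ?_
  have := α.le_oscillation ℓ g (g⁻¹ * y)
  rwa [mul_inv_cancel_left, abs_sub_comm] at this

theorem oscillation_inv (α : CutoffFunction Γ) (ℓ : GroupLength Γ) (g : G) :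
    α.oscillation ℓ g⁻¹ = α.oscillation ℓ g :=
  le_antisymm (α.oscillation_inv_le ℓ g) (by simpa using α.oscillation_inv_le ℓ g⁻¹)

theorem oscillation_mul_le (α : CutoffFunction Γ) (ℓ : GroupLength Γ) (g h : G) :
    α.oscillation ℓ (g * h) ≤ α.oscillation ℓ g + α.oscillation ℓ h := by
  refine ciSup_le fun y => ?_
  have h1 := α.le_oscillation ℓ g (h * y)
  have h2 := α.le_oscillation ℓ h y
  rw [mul_assoc]
  exact (abs_sub_le _ _ _).trans (add_le_add h1 h2)

theorem tendsto_oscillation_one [LocallyCompactSpace G] (α : CutoffFunction Γ)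
    (ℓ : GroupLength Γ) : Filter.Tendsto (α.oscillation ℓ) (𝓝 1) (𝓝 0) := by
  obtain ⟨N, hN, hN1⟩ := exists_compact_mem_nhds (1 : G)
  obtain ⟨S, hS⟩ := α.exists_abs_smoothing_sub_le ℓ hN
  have hα := α.continuous_toFun
  rw [Metric.tendsto_nhds]
  intro ε hε
  have hf : ContinuousOn (Function.uncurry fun g k : G =>
      ∑ γ ∈ S, |α (g * k * γ) - α (k * γ)| * (ℓ γ : ℝ)) (Set.univ ×ˢ α.supp) := by
    refine Continuous.continuousOn (continuous_finsetSum _ fun γ _ => ?_)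
    exact ((hα.comp (by fun_prop)).sub (hα.comp (by fun_prop))).abs.mul continuous_const
  obtain ⟨U, hU, hUk⟩ := α.isCompact_supp.mem_uniformity_of_prod hf (Set.mem_univ (1 : G))
    (Metric.dist_mem_uniformity (half_pos hε))
  rw [nhdsWithin_univ] at hU
  filter_upwards [hU, hN1] with g hg hgN
  rw [Real.dist_eq, sub_zero, abs_of_nonneg (α.oscillation_nonneg ℓ g)]
  refine lt_of_le_of_lt (ciSup_le fun y => ?_) (half_lt_self hε)
  obtain ⟨k, hk, hle⟩ := hS g hgN y
  have := hUk g hg k hk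
  simp only [one_mul, sub_self, abs_zero, zero_mul, Finset.sum_const_zero, Set.mem_ofPred_eq,
    Real.dist_eq, sub_zero] at this
  exact hle.trans ((le_abs_self _).trans this.le)

/-- A length on `G` that controls the given length on `Γ`. -/
noncomputable def inducedLength [LocallyCompactSpace G] (α : CutoffFunction Γ)
    (ℓ : GroupLength Γ) : GroupLength G where
  toFun g := ⟨α.oscillation ℓ g, α.oscillation_nonneg ℓ g⟩
  continuous_toFun := by
    refine Continuous.subtype_mk ?_ _
    rw [continuous_iff_continuousAt]
    intro g₀
    have h1 : Filter.Tendsto (fun g => α.oscillation ℓ (g₀⁻¹ * g)) (𝓝 g₀) (𝓝 0) := by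
      refine (α.tendsto_oscillation_one ℓ).comp ?_
      have : Filter.Tendsto (fun g => g₀⁻¹ * g) (𝓝 g₀) (𝓝 (g₀⁻¹ * g₀)) :=
        (continuous_const_mul _).continuousAt
      rwa [inv_mul_cancel] at this
    rw [ContinuousAt, tendsto_iff_dist_tendsto_zero]
    refine squeeze_zero (fun _ => dist_nonneg) (fun g => ?_) h1
    have h2 := α.oscillation_mul_le ℓ g₀ (g₀⁻¹ * g)
    have h3 := α.oscillation_mul_le ℓ g (g₀⁻¹ * g)⁻¹
    rw [α.oscillation_inv] at h3
    simp only [mul_inv_cancel_left, mul_inv_rev, inv_inv] at h2 h3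
    rw [Real.dist_eq, abs_le]
    constructor <;> linarith
  map_inv g := Subtype.ext (α.oscillation_inv ℓ g)
  map_mul_le g h := α.oscillation_mul_le ℓ g h

/-- The induced length dominates the given one, up to an additive constant, on those `γ` that occur
when an element `g` moves a point `y` of the support of `α` and `γ` moves it back. -/
theorem exists_le_inducedLength [LocallyCompactSpace G] (α : CutoffFunction Γ)
    (ℓ : GroupLength Γ) : ∃ b : ℝ≥0, ∀ (g y : G) (γ : Γ), α y ≠ 0 → α (g * y * γ) ≠ 0 →
      ℓ γ ≤ α.inducedLength ℓ g + b := by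
  set S := α.translates α.isCompact_supp
  set b : ℝ≥0 := ∑ γ ∈ S, ℓ γ
  have hb : ∀ γ ∈ S, ℓ γ ≤ b := fun γ hγ =>
    Finset.single_le_sum (f := fun γ => ℓ γ) (fun _ _ => zero_le) hγ
  refine ⟨b + b, fun g y γ hy hγ => ?_⟩
  have h1 : α.smoothing ℓ y ≤ b := by
    have : α.smoothing ℓ y ≤ ∑ᶠ δ : Γ, α (y * δ) * (b : ℝ) := by
      refine finsum_le_finsum' ?_ ?_ fun δ => ?_
      · exact (α.finite_support y).subset fun δ h => left_ne_zero_of_mul h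
      · exact (α.finite_support y).subset fun δ h => left_ne_zero_of_mul h
      · by_cases h : α (y * δ) = 0
        · simp [h]
        · exact mul_le_mul_of_nonneg_left
            (by exact_mod_cast hb δ (α.mem_translates _ (α.mem_supp hy) h)) (α.nonneg _)
    rwa [← finsum_mul' _ _ (α.finite_support y), α.finsum_eq_one, one_mul] at this
  have h2 : (ℓ γ : ℝ) - b ≤ α.smoothing ℓ (g * y) := by
    have : ∑ᶠ δ : Γ, α (g * y * δ) * ((ℓ γ : ℝ) - b) ≤ α.smoothing ℓ (g * y) := by
      refine finsum_le_finsum' ?_ ?_ fun δ => ?_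
      · exact (α.finite_support _).subset fun δ h => left_ne_zero_of_mul h
      · exact (α.finite_support _).subset fun δ h => left_ne_zero_of_mul h
      · by_cases h : α (g * y * δ) = 0
        · simp [h]
        · refine mul_le_mul_of_nonneg_left ?_ (α.nonneg _)
          have hm : γ⁻¹ * δ ∈ S := α.mem_translates α.isCompact_supp (α.mem_supp hγ)
            (by simpa [mul_assoc] using h)
          have h3 := ℓ.map_mul_le δ (γ⁻¹ * δ)⁻¹
          rw [ℓ.map_inv] at h3
          simp only [mul_inv_rev, inv_inv, mul_inv_cancel_left] at h3
          have h4 : (ℓ γ : ℝ) ≤ ℓ δ + ℓ (γ⁻¹ * δ) := by exact_mod_cast h3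
          have h5 : (ℓ (γ⁻¹ * δ) : ℝ) ≤ b := by exact_mod_cast hb _ hm
          linarith
    rwa [← finsum_mul' _ _ (α.finite_support _), α.finsum_eq_one, one_mul] at this
  have h3 := (le_abs_self _).trans (α.le_oscillation ℓ g y)
  have h4 : (ℓ γ : ℝ) ≤ α.oscillation ℓ g + (b + b) := by linarith
  exact_mod_cast h4

end CutoffFunction

end InducedLength

/-! ### Type conditions and their duals -/

section MatrixBound

variable {Ω ι : Type*} [Fintype Ω] [Fintype ι]

/-- The operator `a ⊗ id : ℓ^r(ι; E) → ℓ^s(Ω; E)` given by the scalar matrix `a` has norm at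
most `K`. -/
def MatrixBound (a : Ω → ι → ℝ) (r s K : ℝ) (E : Type*) [SeminormedAddCommGroup E]
    [NormedSpace ℂ E] : Prop :=
  ∀ x : ι → E, (∑ ω, ‖∑ i, ((a ω i : ℝ) : ℂ) • x i‖ ^ s) ^ (1 / s) ≤
    K * (∑ i, ‖x i‖ ^ r) ^ (1 / r)

/-- The transposed matrix satisfies the dual bound on every space `X` that is normed by a pairing
with `Y`. -/
theorem MatrixBound.transpose {a : Ω → ι → ℝ} {r r' s s' K : ℝ} (hr : r.HolderConjugate r')
    (hs : s.HolderConjugate s') (hK : 0 ≤ K) {X Y : Type*} [SeminormedAddCommGroup X]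
    [NormedSpace ℂ X] [SeminormedAddCommGroup Y] [NormedSpace ℂ Y] (B : X →ₗ[ℂ] Y →ₗ[ℂ] ℂ)
    (hB : ∀ x y, ‖B x y‖ ≤ ‖x‖ * ‖y‖)
    (hn : ∀ x : X, ∀ θ < (1 : ℝ), ∃ y : Y, ‖y‖ ≤ 1 ∧ θ * ‖x‖ ≤ ‖B x y‖)
    (h : MatrixBound a r s K Y) : MatrixBound (fun i ω => a ω i) s' r' K X := by
  intro x
  set z : ι → X := fun i => ∑ ω, ((a ω i : ℝ) : ℂ) • x ω with hz
  set S := ∑ i, ‖z i‖ ^ r' with hS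
  set L := (∑ ω, ‖x ω‖ ^ s') ^ (1 / s') with hL
  have hS0 : 0 ≤ S := Finset.sum_nonneg fun i _ => by positivity
  have hL0 : 0 ≤ L := by positivity
  have hr'0 : 0 < r' := hr.symm.pos
  rcases hS0.eq_or_lt with hS1 | hS1
  · rw [← hS1, Real.zero_rpow (by positivity)]; positivity
  have main : ∀ θ : ℝ, θ < 1 → θ * S ≤ L * (K * S ^ (1 / r)) := by
    intro θ hθ
    have hn' : ∀ i, ∃ y : Y, ‖y‖ ≤ 1 ∧ θ * ‖z i‖ ≤ (B (z i) y).re := by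
      intro i
      obtain ⟨y, hy1, hy2⟩ := hn (z i) θ hθ
      obtain ⟨c, hc1, hc2⟩ := RCLike.exists_norm_eq_mul_self (B (z i) y)
      refine ⟨c • y, ?_, ?_⟩
      · rwa [norm_smul, hc1, one_mul]
      · rw [map_smul, smul_eq_mul, ← hc2]
        simpa using hy2
    choose y hy1 hy2 using hn'
    set w : ι → Y := fun i => (((‖z i‖ ^ (r' - 1) : ℝ)) : ℂ) • y i with hw
    have hwn : ∑ i, ‖w i‖ ^ r ≤ S := by
      refine Finset.sum_le_sum fun i _ => ?_
      have h1 : ‖w i‖ ≤ ‖z i‖ ^ (r' - 1) := by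
        rw [hw, norm_smul, Complex.norm_real, Real.norm_of_nonneg (by positivity)]
        exact mul_le_of_le_one_right (by positivity) (hy1 i)
      calc ‖w i‖ ^ r ≤ (‖z i‖ ^ (r' - 1)) ^ r :=
            Real.rpow_le_rpow (norm_nonneg _) h1 hr.pos.le
        _ = ‖z i‖ ^ r' := by
            rw [← Real.rpow_mul (norm_nonneg _), hr.symm.sub_one_mul_conj]
    have e1 : ∀ i, θ * ‖z i‖ ^ r' ≤ (B (z i) (w i)).re := by
      intro i
      rw [hw, map_smul, smul_eq_mul, Complex.re_ofReal_mul]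
      have h2 : ‖z i‖ ^ r' = ‖z i‖ ^ (r' - 1) * ‖z i‖ := by
        rcases (norm_nonneg (z i)).eq_or_lt with h0 | h0
        · rw [← h0, Real.zero_rpow hr'0.ne', mul_zero]
        · rw [Real.rpow_sub_one h0.ne', div_mul_cancel₀ _ h0.ne']
      rw [h2, mul_left_comm]
      exact mul_le_mul_of_nonneg_left (hy2 i) (by positivity)
    have e2 : ∑ i, B (z i) (w i) = ∑ ω, B (x ω) (∑ i, ((a ω i : ℝ) : ℂ) • w i) := by
      simp only [hz, map_sum, map_smul, LinearMap.sum_apply, LinearMap.smul_apply]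
      exact Finset.sum_comm
    calc θ * S ≤ ∑ i, (B (z i) (w i)).re := by
          rw [hS, Finset.mul_sum]; exact Finset.sum_le_sum fun i _ => e1 i
      _ = (∑ ω, B (x ω) (∑ i, ((a ω i : ℝ) : ℂ) • w i)).re := by rw [← e2, Complex.re_sum]
      _ ≤ ∑ ω, ‖x ω‖ * ‖∑ i, ((a ω i : ℝ) : ℂ) • w i‖ :=
          (Complex.re_le_norm _).trans ((norm_sum_le _ _).trans
            (Finset.sum_le_sum fun ω _ => hB _ _))
      _ ≤ L * (∑ ω, ‖∑ i, ((a ω i : ℝ) : ℂ) • w i‖ ^ s) ^ (1 / s) :=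
          Real.inner_le_Lp_mul_Lq_of_nonneg _ hs.symm (fun _ _ => norm_nonneg _)
            fun _ _ => norm_nonneg _
      _ ≤ L * (K * S ^ (1 / r)) := by
          refine mul_le_mul_of_nonneg_left ((h w).trans ?_) hL0
          refine mul_le_mul_of_nonneg_left ?_ hK
          exact Real.rpow_le_rpow (Finset.sum_nonneg fun i _ => by positivity) hwn
            hr.one_div_nonneg
  have main1 : S ≤ L * (K * S ^ (1 / r)) := by
    have ht : Filter.Tendsto (fun θ : ℝ => θ * S) (𝓝[<] 1) (𝓝 (1 * S)) :=
      (Filter.Tendsto.mul_const S Filter.tendsto_id).mono_left nhdsWithin_le_nhds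
    rw [one_mul] at ht
    exact le_of_tendsto ht (Filter.eventually_of_mem self_mem_nhdsWithin fun θ hθ => main θ hθ)
  have hS2 : S = S ^ (1 / r') * S ^ (1 / r) := by
    rw [← Real.rpow_add hS1, one_div, one_div, add_comm, hr.inv_add_inv_eq_one, Real.rpow_one]
  have hpos : 0 < S ^ (1 / r) := Real.rpow_pos_of_pos hS1 _
  refine le_of_mul_le_mul_right ?_ hpos
  calc S ^ (1 / r') * S ^ (1 / r) = S := hS2.symm
    _ ≤ L * (K * S ^ (1 / r)) := main1
    _ = K * L * S ^ (1 / r) := by ring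

theorem MatrixBound.dual {a : Ω → ι → ℝ} {r r' s s' K : ℝ} (hr : r.HolderConjugate r')
    (hs : s.HolderConjugate s') (hK : 0 ≤ K) {E : Type*} [NormedAddCommGroup E]
    [NormedSpace ℂ E] (h : MatrixBound a r s K E) :
    MatrixBound (fun i ω => a ω i) s' r' K (StrongDual ℂ E) := by
  refine h.transpose hr hs hK (ContinuousLinearMap.coeLM ℂ) (fun f x => f.le_opNorm x) ?_
  intro f θ hθ
  rcases (norm_nonneg f).eq_or_lt with h0 | h0
  · exact ⟨0, by simp, by simp [← h0]⟩
  · obtain ⟨x, hx, hx'⟩ := f.exists_lt_apply_of_lt_opNorm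
      (mul_lt_of_lt_one_left h0 hθ)
    exact ⟨x, hx.le, hx'.le⟩

theorem MatrixBound.predual {a : Ω → ι → ℝ} {r r' s s' K : ℝ} (hr : r.HolderConjugate r')
    (hs : s.HolderConjugate s') (hK : 0 ≤ K) {E : Type*} [NormedAddCommGroup E]
    [NormedSpace ℂ E] (h : MatrixBound a r s K (StrongDual ℂ E)) :
    MatrixBound (fun i ω => a ω i) s' r' K E := by
  refine h.transpose hr hs hK (ContinuousLinearMap.coeLM ℂ).flip
    (fun x f => (f.le_opNorm x).trans_eq (mul_comm _ _)) ?_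
  intro x θ hθ
  obtain ⟨f, hf, hfx⟩ := exists_dual_vector'' ℂ x
  refine ⟨f, hf, ?_⟩
  have : ‖f x‖ = ‖x‖ := by rw [hfx]; simp
  exact (mul_le_of_le_one_left (norm_nonneg x) hθ.le).trans this.ge

theorem MatrixBound.conj {a : Ω → ι → ℝ} {r s K : ℝ} {E : Type*} [NormedAddCommGroup E]
    [NormedSpace ℂ E] (h : MatrixBound a r s K E) : MatrixBound a r s K (ConjSpace E) := by
  intro x
  have hx : ∀ ω, (∑ i, ((a ω i : ℝ) : ℂ) • x i : ConjSpace E) =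
      (∑ i, ((a ω i : ℝ) : ℂ) • (show E from x i) : E) := by
    intro ω
    refine Finset.sum_congr rfl fun i _ => ?_
    change ((starRingEnd ℂ ((a ω i : ℝ) : ℂ)) • (show E from x i) : E) = _
    rw [Complex.conj_ofReal]
  have := h (fun i => (show E from x i))
  simp_rw [← hx] at this
  exact this

/-- A bound on a dense subspace extends to the whole space. -/
theorem MatrixBound.of_dense {a : Ω → ι → ℝ} {r s K : ℝ} (hr : 0 < r) (hs : 0 < s)
    {V F : Type*} [SeminormedAddCommGroup V]
    [NormedSpace ℂ V] [SeminormedAddCommGroup F] [NormedSpace ℂ F] (j : V →ₗᵢ[ℂ] F)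
    (hj : DenseRange j) (h : MatrixBound a r s K V) : MatrixBound a r s K F := by
  intro x
  have hd : DenseRange (Pi.map fun _ : ι => (j : V → F)) := DenseRange.piMap fun _ => hj
  have hc : ∀ {t : ℝ}, 0 < t → Continuous fun y : ℝ => y ^ t := fun ht =>
    Real.continuous_rpow_const ht.le
  refine hd.induction_on (p := fun x : ι → F =>
    (∑ ω, ‖∑ i, ((a ω i : ℝ) : ℂ) • x i‖ ^ s) ^ (1 / s) ≤
      K * (∑ i, ‖x i‖ ^ r) ^ (1 / r)) x ?_ ?_
  · refine isClosed_le ?_ ?_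
    · refine (hc (one_div_pos.2 hs)).comp (continuous_finsetSum _ fun ω _ => (hc hs).comp ?_)
      fun_prop
    · refine continuous_const.mul ((hc (one_div_pos.2 hr)).comp
        (continuous_finsetSum _ fun i _ => (hc hr).comp ?_))
      fun_prop
  · intro y
    have := h y
    simpa only [Pi.map_apply, ← map_smul, ← map_sum, j.norm_map] using this

end MatrixBound

section TypeClass

/-- The matrix of all sign vectors of length `n`. -/
def signMatrix (n : ℕ) (ε : Fin n → ℤˣ) (i : Fin n) : ℝ := ((ε i : ℤ) : ℝ)

/-- The spaces `E` such that both `E` and `E*` have type `q` with constant `T`; the condition on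
`E*` is phrased on `E` itself, as a bound for the transposed matrix. -/
def typeDualTypeClass (q T : ℝ) : Set BanachSp.{v} :=
  {E | ∀ n : ℕ,
    MatrixBound (signMatrix n) q 2 (T * √(Fintype.card (Fin n → ℤˣ))) E ∧
    MatrixBound (fun i ε => signMatrix n ε i) 2 q.conjExponent
      (T * √(Fintype.card (Fin n → ℤˣ))) E}

theorem stableUnderDuality_typeDualTypeClass {q T : ℝ} (hq : 1 < q) (hT : 0 ≤ T) :
    StableUnderDuality (typeDualTypeClass.{v} q T) := fun _ hE n =>
  have hq' := Real.HolderConjugate.conjExponent hq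
  ⟨(hE n).2.dual .two_two hq'.symm (by positivity),
    (hE n).1.dual hq' .two_two (by positivity)⟩

theorem stableUnderConj_typeDualTypeClass {q T : ℝ} :
    StableUnderConj (typeDualTypeClass.{v} q T) := fun _ hE n =>
  ⟨(hE n).1.conj, (hE n).2.conj⟩

/-- The type inequality, as a bound for the sign matrix. -/
theorem matrixBound_signMatrix_iff {E : Type*} [NormedAddCommGroup E] [NormedSpace ℂ E] {n : ℕ}
    {p T : ℝ} : MatrixBound (signMatrix n) p 2 (T * √(Fintype.card (Fin n → ℤˣ))) E ↔
      ∀ x : Fin n → E, Real.sqrt (𝔼 ε : Fin n → ℤˣ, ‖∑ i, ((ε i : ℤ) : ℂ) • x i‖ ^ 2) ≤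
        T * (∑ i, ‖x i‖ ^ p) ^ (1 / p) := by
  have hN : (0 : ℝ) < √(Fintype.card (Fin n → ℤˣ)) :=
    Real.sqrt_pos.2 (Nat.cast_pos.2 Fintype.card_pos)
  refine forall_congr' fun x => ?_
  rw [Fintype.expect_eq_sum_div_card, Real.sqrt_div' _ (Nat.cast_nonneg _), div_le_iff₀ hN,
    Real.sqrt_eq_rpow (∑ ε : Fin n → ℤˣ, _)]
  simp only [signMatrix, Real.rpow_two, Complex.ofReal_intCast]
  rw [mul_right_comm]

theorem isOfTypeGTOne_typeDualTypeClass {q T : ℝ} (hq : 1 < q) (hT : 0 ≤ T) :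
    IsOfTypeGTOne (typeDualTypeClass.{v} q T) :=
  ⟨q, hq, T, hT, fun _ hE n => matrixBound_signMatrix_iff.1 (hE n).1⟩

theorem sum_rpow_le_of_le {ι : Type*} [Fintype ι] {p q : ℝ} (hq : 0 < q) (hqp : q ≤ p)
    (u : ι → ℝ) (hu : ∀ i, 0 ≤ u i) :
    (∑ i, u i ^ p) ^ (1 / p) ≤ (∑ i, u i ^ q) ^ (1 / q) := by
  have hp : 0 < p := hq.trans_le hqp
  set M := (∑ i, u i ^ q) ^ (1 / q) with hM
  have hS : 0 ≤ ∑ i, u i ^ q := Finset.sum_nonneg fun i _ => Real.rpow_nonneg (hu i) _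
  have hM0 : 0 ≤ M := by positivity
  have hMq : M ^ q = ∑ i, u i ^ q := by
    rw [hM, ← Real.rpow_mul hS, one_div_mul_cancel hq.ne', Real.rpow_one]
  have huM : ∀ i, u i ≤ M := by
    intro i
    rw [hM, one_div, Real.le_rpow_inv_iff_of_pos (hu i) hS hq]
    exact Finset.single_le_sum (f := fun i => u i ^ q)
      (fun i _ => Real.rpow_nonneg (hu i) _) (Finset.mem_univ i)
  rw [one_div, Real.rpow_inv_le_iff_of_pos (Finset.sum_nonneg fun i _ =>
    Real.rpow_nonneg (hu i) _) hM0 hp]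
  calc ∑ i, u i ^ p ≤ ∑ i, u i ^ q * M ^ (p - q) := by
        refine Finset.sum_le_sum fun i _ => ?_
        rcases (hu i).eq_or_lt with h0 | h0
        · rw [← h0, Real.zero_rpow hp.ne', Real.zero_rpow hq.ne', zero_mul]
        · calc u i ^ p = u i ^ q * u i ^ (p - q) := by
                rw [← Real.rpow_add h0]; congr 1; ring
            _ ≤ _ := mul_le_mul_of_nonneg_left
                (Real.rpow_le_rpow h0.le (huM i) (by linarith)) (by positivity)
    _ = M ^ q * M ^ (p - q) := by rw [← Finset.sum_mul, hMq]
    _ = M ^ p := by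
        rcases hM0.eq_or_lt with h0 | h0
        · rw [← h0, Real.zero_rpow hp.ne', Real.zero_rpow hq.ne', zero_mul]
        · rw [← Real.rpow_add h0]; congr 1; ring

theorem MatrixBound.of_le {Ω ι : Type*} [Fintype Ω] [Fintype ι] {a : Ω → ι → ℝ} {p q s K : ℝ}
    (hK : 0 ≤ K) (hq : 0 < q) (hqp : q ≤ p) {E : Type*} [SeminormedAddCommGroup E]
    [NormedSpace ℂ E] (h : MatrixBound a p s K E) : MatrixBound a q s K E := fun x =>
  (h x).trans (mul_le_mul_of_nonneg_left
    (sum_rpow_le_of_le hq hqp _ fun _ => norm_nonneg _) hK)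

/-- A class of type `> 1` that is stable under duality consists of spaces which, together with
their duals, have type `q` for some `q ∈ (1, 2]`. -/
theorem IsOfTypeGTOne.exists_subset_typeDualTypeClass {𝓔 : Set BanachSp.{v}}
    (h : IsOfTypeGTOne 𝓔) (hd : StableUnderDuality 𝓔) :
    ∃ q T : ℝ, 1 < q ∧ q ≤ 2 ∧ 0 ≤ T ∧ 𝓔 ⊆ typeDualTypeClass q T := by
  obtain ⟨p, hp, T, hT, h⟩ := h
  have hq : 1 < min p 2 := lt_min hp one_lt_two
  have h1 : ∀ E ∈ 𝓔, ∀ n : ℕ,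
      MatrixBound (signMatrix n) (min p 2) 2 (T * √(Fintype.card (Fin n → ℤˣ))) E :=
    fun E hE n => (matrixBound_signMatrix_iff.2 (h E hE n)).of_le (by positivity)
      (by linarith) (min_le_left _ _)
  refine ⟨min p 2, T, hq, min_le_right _ _, hT, fun E hE n => ⟨h1 E hE n, ?_⟩⟩
  exact (h1 E.dual (hd E hE) n).predual (Real.HolderConjugate.conjExponent hq) .two_two
    (by positivity)

end TypeClass

/-! ### Equivariant maps with the induced seminorm -/

section InducedSpace

variable {G : Type*} [Group G] [TopologicalSpace G] {Γ : Subgroup G}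

/-- The continuous maps `f : G → E` with `f (h γ) = π(γ)⁻¹ f(h)`. -/
def equivariantMaps {E : Type*} [NormedAddCommGroup E] [NormedSpace ℂ E]
    (π : Γ →* (E →L[ℂ] E)) : Submodule ℂ C(G, E) where
  carrier := {f | ∀ (h : G) (γ : Γ), f (h * γ) = π γ⁻¹ (f h)}
  add_mem' hf hg h γ := by simp [hf h γ, hg h γ]
  zero_mem' := by simp
  smul_mem' c f hf h γ := by simp [hf h γ]

/-- The space of continuous equivariant maps `G → E`, to be equipped with the seminorm
`(∫ α(h) ‖f h‖² dh)^(1/2)`, which is the `L²`-norm on a (weighted) fundamental domain. -/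
def PreInduced (_α : CutoffFunction Γ) {E : Type*} [NormedAddCommGroup E] [NormedSpace ℂ E]
    (π : Γ →* (E →L[ℂ] E)) : Type _ := equivariantMaps (G := G) π

variable {E : Type*} [NormedAddCommGroup E] [NormedSpace ℂ E] {α : CutoffFunction Γ}
  {π : Γ →* (E →L[ℂ] E)}

namespace PreInduced

instance : AddCommGroup (PreInduced α π) :=
  inferInstanceAs (AddCommGroup (equivariantMaps (G := G) π))

instance : Module ℂ (PreInduced α π) :=
  inferInstanceAs (Module ℂ (equivariantMaps (G := G) π))

/-- The underlying continuous map. -/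
def toContinuousMap (f : PreInduced α π) : C(G, E) := (id f : equivariantMaps (G := G) π).1

instance : CoeFun (PreInduced α π) (fun _ => G → E) := ⟨fun f => f.toContinuousMap⟩

theorem continuous (f : PreInduced α π) : Continuous f := f.toContinuousMap.continuous

theorem apply_mul (f : PreInduced α π) (h : G) (γ : Γ) : f (h * γ) = π γ⁻¹ (f h) :=
  (id f : equivariantMaps (G := G) π).2 h γ

/-- An equivariant continuous map, as an element of the space. -/
def mk (f : G → E) (hf : Continuous f) (h : ∀ (h : G) (γ : Γ), f (h * γ) = π γ⁻¹ (f h)) :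
    PreInduced α π := (⟨⟨f, hf⟩, h⟩ : equivariantMaps (G := G) π)

@[simp] theorem add_apply (f g : PreInduced α π) (h : G) : (f + g) h = f h + g h := rfl

@[simp] theorem smul_apply (c : ℂ) (f : PreInduced α π) (h : G) : (c • f) h = c • f h := rfl

@[simp] theorem sum_apply {ι : Type*} (s : Finset ι) (f : ι → PreInduced α π) (h : G) :
    (∑ i ∈ s, f i) h = ∑ i ∈ s, f i h := by
  let ev : PreInduced α π →+ E :=
    { toFun := fun f => f h, map_zero' := rfl, map_add' := fun _ _ => rfl }
  exact map_sum ev f s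

theorem continuous_sqrt_smul (f : PreInduced α π) :
    Continuous fun h => ((√(α h) : ℝ) : ℂ) • f h :=
  (Complex.continuous_ofReal.comp α.continuous_toFun.sqrt).smul f.continuous

theorem hasCompactSupport_sqrt_smul (f : PreInduced α π) :
    HasCompactSupport fun h => ((√(α h) : ℝ) : ℂ) • f h :=
  (α.hasCompactSupport.comp_left (g := fun t : ℝ => ((√t : ℝ) : ℂ)) (by simp)).smul_right

theorem exists_norm_le [IsTopologicalGroup G] [T2Space G]
    [DiscreteTopology Γ] (π : Γ →* (E →L[ℂ] E)) (α : CutoffFunction Γ) (g : G) :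
    ∃ M : ℝ, 0 ≤ M ∧
    ∀ (y : G) (γ : Γ), α y ≠ 0 → α (g * y * γ) ≠ 0 → ‖π γ⁻¹‖ ≤ M := by
  have hQ : IsCompact ((g * ·) '' α.supp) := α.isCompact_supp.image (continuous_const_mul g)
  refine ⟨∑ γ ∈ α.translates hQ, ‖π γ⁻¹‖, Finset.sum_nonneg fun _ _ => norm_nonneg _,
    fun y γ hy hγ => ?_⟩
  exact Finset.single_le_sum (f := fun γ : Γ => ‖π γ⁻¹‖) (fun _ _ => norm_nonneg _)
    (α.mem_translates hQ ⟨y, α.mem_supp hy, rfl⟩ hγ)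

variable [MeasurableSpace G] [BorelSpace G] [IsTopologicalGroup G] [LocallyCompactSpace G]

theorem memLp_sqrt_smul (f : PreInduced α π) :
    MemLp (fun h => ((√(α h) : ℝ) : ℂ) • f h) 2 (Measure.haar : Measure G) :=
  f.continuous_sqrt_smul.memLp_of_hasCompactSupport f.hasCompactSupport_sqrt_smul

/-- The map `f ↦ √α f` into `L²(G; E)` from which the seminorm is induced. -/
noncomputable def toLp : PreInduced α π →ₗ[ℂ] Lp E 2 (Measure.haar : Measure G) where
  toFun f := f.memLp_sqrt_smul.toLp _
  map_add' f g := by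
    rw [← MemLp.toLp_add]
    congr 1; ext h; simp
  map_smul' c f := by
    rw [RingHom.id_apply, ← MemLp.toLp_const_smul]
    congr 1; ext h
    simp only [smul_apply, Pi.smul_apply]
    exact smul_comm _ _ _

noncomputable instance : SeminormedAddCommGroup (PreInduced α π) :=
  SeminormedAddCommGroup.induced (PreInduced α π) (Lp E 2 (Measure.haar : Measure G)) toLp

noncomputable instance : NormedSpace ℂ (PreInduced α π) :=
  NormedSpace.induced ℂ (PreInduced α π) (Lp E 2 (Measure.haar : Measure G)) toLp

theorem norm_sq (f : PreInduced α π) :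
    ‖f‖ ^ 2 = ∫ h, α h * ‖f h‖ ^ 2 ∂(Measure.haar : Measure G) := by
  have h1 : ‖f‖ = ‖f.memLp_sqrt_smul.toLp _‖ := rfl
  rw [h1, Lp.norm_toLp, toReal_eLpNorm f.memLp_sqrt_smul.1,
    lpNorm_eq_integral_norm_rpow_toReal (by norm_num) (by norm_num) f.memLp_sqrt_smul.1]
  simp only [ENNReal.toReal_ofNat, Real.rpow_two]
  rw [← Real.rpow_natCast, ← Real.rpow_mul (integral_nonneg fun _ => by positivity)]
  norm_num
  congr 1; ext h
  rw [norm_smul, mul_pow, Real.norm_eq_abs, sq_abs, Real.sq_sqrt (α.nonneg h)]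

theorem integrable_mul_norm_pow (f : PreInduced α π) {ψ : G → ℝ} (hψ : Continuous ψ)
    (hψc : HasCompactSupport ψ) (k : ℕ) :
    Integrable (fun h => ψ h * ‖f h‖ ^ k) (Measure.haar : Measure G) :=
  (hψ.mul (f.continuous.norm.pow k)).integrable_of_hasCompactSupport hψc.mul_right

/-- Cauchy-Schwarz. -/
theorem integral_mul_norm_le (f : PreInduced α π) :
    ∫ h, α h * ‖f h‖ ∂(Measure.haar : Measure G) ≤
      √(∫ h, α h ∂(Measure.haar : Measure G)) * ‖f‖ := by
  have hc : Continuous fun h => √(α h) := α.continuous_toFun.sqrt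
  have hs : HasCompactSupport fun h => √(α h) :=
    α.hasCompactSupport.comp_left (g := Real.sqrt) Real.sqrt_zero
  have hm : ∀ {u : G → ℝ}, Continuous u → HasCompactSupport u →
      MemLp u (ENNReal.ofReal 2) (Measure.haar : Measure G) :=
    fun h1 h2 => h1.memLp_of_hasCompactSupport h2
  have := integral_mul_le_Lp_mul_Lq_of_nonneg (μ := (Measure.haar : Measure G))
    Real.HolderConjugate.two_two (f := fun h => √(α h)) (g := fun h => √(α h) * ‖f h‖)
    (Filter.Eventually.of_forall fun _ => Real.sqrt_nonneg _)
    (Filter.Eventually.of_forall fun _ => by positivity)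
    (hm hc hs) (hm (hc.mul f.continuous.norm) hs.mul_right)
  simp only [← mul_assoc, Real.mul_self_sqrt (α.nonneg _), Real.rpow_two, mul_pow,
    Real.sq_sqrt (α.nonneg _), ← norm_sq, ← Real.sqrt_eq_rpow] at this
  rwa [Real.sqrt_sq (norm_nonneg f)] at this

variable [T2Space G] [DiscreteTopology Γ]

/-- Weighted `L^k`-integrals of an equivariant map are controlled by those with weight `α`. -/
theorem integral_mul_norm_pow_le (f : PreInduced α π) {ψ : G → ℝ} (hψ : Continuous ψ)
    (hψc : HasCompactSupport ψ) (hψ0 : ∀ h, 0 ≤ ψ h) (k : ℕ) {C : ℝ}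
    (hC : ∀ h, α h ≠ 0 → ∑ᶠ γ : Γ, ψ (h * γ) * ‖π γ⁻¹‖ ^ k ≤ C) :
    ∫ h, ψ h * ‖f h‖ ^ k ∂(Measure.haar : Measure G) ≤
      C * ∫ h, α h * ‖f h‖ ^ k ∂(Measure.haar : Measure G) := by
  have := α.isMulRightInvariant_haar
  have hu : Continuous fun h => ψ h * ‖f h‖ ^ k := hψ.mul (f.continuous.norm.pow k)
  rw [α.integral_eq_integral_mul_finsum Measure.haar hu hψc.mul_right, ← integral_const_mul]
  have hmem : ∀ (γ : Γ) h, ψ (h * γ) ≠ 0 → h * (γ : G) ∈ tsupport ψ :=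
    fun γ h hh => subset_tsupport _ hh
  refine integral_mono ?_ ((f.integrable_mul_norm_pow α.continuous_toFun α.hasCompactSupport
    k).const_mul C) fun h => ?_
  · refine Continuous.integrable_of_hasCompactSupport (α.continuous_toFun.mul ?_)
      α.hasCompactSupport.mul_right
    exact continuous_finsum_of_mul_mem Γ hψc (F := fun γ h => ψ (h * γ) * ‖f (h * γ)‖ ^ k)
      (fun γ => hu.comp (continuous_mul_const _))
      fun γ h hh => hmem γ h (left_ne_zero_of_mul hh)
  · by_cases h0 : α h = 0
    · simp [h0]
    have h1 : ∑ᶠ γ : Γ, ψ (h * γ) * ‖f (h * γ)‖ ^ k ≤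
        ∑ᶠ γ : Γ, ψ (h * γ) * ‖π γ⁻¹‖ ^ k * ‖f h‖ ^ k := by
      refine finsum_le_finsum' ?_ ?_ fun γ => ?_
      · exact finite_support_of_mul_mem Γ hψc h fun γ hh => hmem γ h (left_ne_zero_of_mul hh)
      · exact finite_support_of_mul_mem Γ hψc h fun γ hh =>
          hmem γ h (left_ne_zero_of_mul (left_ne_zero_of_mul hh))
      · simp only
        rw [mul_assoc, ← mul_pow, apply_mul]
        exact mul_le_mul_of_nonneg_left
          (pow_le_pow_left₀ (norm_nonneg _) ((π γ⁻¹).le_opNorm _) k) (hψ0 _)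
    rw [← finsum_mul' _ _ (finite_support_of_mul_mem Γ hψc h fun γ hh =>
      hmem γ h (left_ne_zero_of_mul hh))] at h1
    calc α h * ∑ᶠ γ : Γ, ψ (h * γ) * ‖f (h * γ)‖ ^ k ≤ α h * (C * ‖f h‖ ^ k) :=
          mul_le_mul_of_nonneg_left (h1.trans (mul_le_mul_of_nonneg_right (hC h h0)
            (by positivity))) (α.nonneg h)
      _ = _ := by ring

/-- Left translation `f ↦ f (g⁻¹ · )` of equivariant maps. -/
def translateₗ (g : G) : PreInduced α π →ₗ[ℂ] PreInduced α π where
  toFun f := mk (fun h => f (g⁻¹ * h)) (f.continuous.comp (continuous_const_mul _)) fun h γ => by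
    simpa [mul_assoc] using f.apply_mul (g⁻¹ * h) γ
  map_add' _ _ := rfl
  map_smul' _ _ := rfl

theorem norm_translateₗ_le (g : G) {M : ℝ} (hM0 : 0 ≤ M)
    (hM : ∀ (y : G) (γ : Γ), α y ≠ 0 → α (g * y * γ) ≠ 0 → ‖π γ⁻¹‖ ≤ M) (f : PreInduced α π) :
    ‖translateₗ g f‖ ≤ M * ‖f‖ := by
  refine (pow_le_pow_iff_left₀ (norm_nonneg _) (by positivity) two_ne_zero).1 ?_
  have e : ∫ h, α h * ‖f (g⁻¹ * h)‖ ^ 2 ∂(Measure.haar : Measure G) =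
      ∫ h, α (g * h) * ‖f h‖ ^ 2 ∂(Measure.haar : Measure G) := by
    rw [← integral_mul_left_eq_self _ g]
    simp
  rw [mul_pow, norm_sq, norm_sq]
  change ∫ h, α h * ‖f (g⁻¹ * h)‖ ^ 2 ∂(Measure.haar : Measure G) ≤ _
  rw [e]
  refine f.integral_mul_norm_pow_le (α.continuous_toFun.comp (continuous_const_mul g))
    (α.hasCompactSupport.comp_homeomorph (Homeomorph.mulLeft g)) (fun h => α.nonneg _) 2
    fun h hh => ?_
  calc ∑ᶠ γ : Γ, α (g * (h * γ)) * ‖π γ⁻¹‖ ^ 2 ≤ ∑ᶠ γ : Γ, α (g * h * γ) * M ^ 2 := by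
        refine finsum_le_finsum' ?_ ?_ fun γ => ?_
        · exact (α.finite_support (g * h)).subset fun γ hγ => by
            simpa [mul_assoc] using left_ne_zero_of_mul hγ
        · exact (α.finite_support (g * h)).subset fun γ hγ => left_ne_zero_of_mul hγ
        · simp only [← mul_assoc g h]
          by_cases h0 : α (g * h * γ) = 0
          · simp [h0]
          · exact mul_le_mul_of_nonneg_left
              (pow_le_pow_left₀ (norm_nonneg _) (hM h γ hh h0) 2) (α.nonneg _)
    _ = M ^ 2 := by
        rw [← finsum_mul' _ _ (α.finite_support _), α.finsum_eq_one, one_mul]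

/-- Left translation as a continuous linear map. -/
noncomputable def translate (g : G) : PreInduced α π →L[ℂ] PreInduced α π :=
  LinearMap.mkContinuousOfExistsBound (translateₗ g) <|
    let ⟨M, hM0, hM⟩ := exists_norm_le π α g
    ⟨M, norm_translateₗ_le g hM0 hM⟩

@[simp] theorem translate_apply (g : G) (f : PreInduced α π) (h : G) :
    translate g f h = f (g⁻¹ * h) := rfl

theorem continuous_translate (f : PreInduced α π) :
    Continuous fun g : G => translate g f := by
  rw [continuous_iff_continuousAt]
  intro g₀
  have h1 : ContinuousOn (fun g : G => ∫ h, α h * ‖f (g⁻¹ * h) - f (g₀⁻¹ * h)‖ ^ 2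
      ∂(Measure.haar : Measure G)) Set.univ := by
    refine continuousOn_integral_of_compact_support α.isCompact_supp ?_ ?_
    · refine Continuous.continuousOn ?_
      have := f.continuous
      have := α.continuous_toFun
      unfold Function.uncurry
      fun_prop
    · intro g h _ hh
      rw [image_eq_zero_of_notMem_tsupport hh, zero_mul]
  have h2 : Filter.Tendsto (fun g : G => ‖translate g f - translate g₀ f‖ ^ 2) (𝓝 g₀) (𝓝 0) := by
    have h3 := (continuousOn_univ.1 h1).tendsto g₀
    simp only [sub_self, norm_zero, ne_eq, OfNat.ofNat_ne_zero, not_false_eq_true, zero_pow,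
      mul_zero, integral_zero] at h3
    refine h3.congr fun g => ?_
    rw [norm_sq]
    rfl
  rw [ContinuousAt, tendsto_iff_norm_sub_tendsto_zero]
  have h4 := (Real.continuous_sqrt.tendsto 0).comp h2
  simpa [Function.comp_def, Real.sqrt_sq (norm_nonneg _)] using h4

end PreInduced

end InducedSpace

/-! ### The induced representation -/

section Minkowski

variable {X : Type*} [MeasurableSpace X] {μ : Measure X} {ι : Type*} [Fintype ι]

/-- Minkowski's inequality: the `ℓ^t`-norm of an integral is at most the integral of the
`ℓ^t`-norms. -/
theorem sum_integral_rpow_le_integral {t : ℝ} (ht : 1 ≤ t) {v : ι → X → ℝ}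
    (hv : ∀ i, Integrable (v i) μ) (hv0 : ∀ i x, 0 ≤ v i x) :
    (∑ i, (∫ x, v i x ∂μ) ^ t) ^ (1 / t) ≤ ∫ x, (∑ i, v i x ^ t) ^ (1 / t) ∂μ := by
  have ht0 : 0 < t := one_pos.trans_le ht
  have : Fact (1 ≤ ENNReal.ofReal t) := ⟨by rwa [ENNReal.one_le_ofReal]⟩
  have htr : (ENNReal.ofReal t).toReal = t := ENNReal.toReal_ofReal ht0.le
  let f : X → PiLp (ENNReal.ofReal t) (fun _ : ι => ℝ) := fun x => WithLp.toLp _ fun i => v i x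
  have hn : ∀ w : PiLp (ENNReal.ofReal t) (fun _ : ι => ℝ), (∀ i, 0 ≤ w i) →
      ‖w‖ = (∑ i, w i ^ t) ^ (1 / t) := by
    intro w hw
    rw [PiLp.norm_eq_sum (by rw [htr]; exact ht0), htr]
    simp [abs_of_nonneg (hw _)]
  have hi : ∀ i, (∫ x, f x ∂μ) i = ∫ x, v i x ∂μ := fun i => eval_integral_piLp hv i
  have h := norm_integral_le_integral_norm (μ := μ) f
  rw [hn _ fun i => by rw [hi]; exact integral_nonneg (hv0 i)] at h
  simp_rw [hi, hn (f _) (hv0 · _)] at h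
  exact h

/-- Minkowski's inequality for a finite sum in `L^t`. -/
theorem integral_sum_rpow_le {t : ℝ} (ht : 1 ≤ t) {w : ι → X → ℝ}
    (hw : ∀ i, MemLp (w i) (ENNReal.ofReal t) μ) (hw0 : ∀ i x, 0 ≤ w i x) :
    (∫ x, (∑ i, w i x) ^ t ∂μ) ^ (1 / t) ≤ ∑ i, (∫ x, w i x ^ t ∂μ) ^ (1 / t) := by
  have ht0 : 0 < t := one_pos.trans_le ht
  have htr : (ENNReal.ofReal t).toReal = t := ENNReal.toReal_ofReal ht0.le
  have hn : ∀ u : X → ℝ, MemLp u (ENNReal.ofReal t) μ → (∀ x, 0 ≤ u x) →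
      lpNorm u (ENNReal.ofReal t) μ = (∫ x, u x ^ t ∂μ) ^ (1 / t) := by
    intro u hu hu0
    rw [lpNorm_eq_integral_norm_rpow_toReal (by simpa using ht0) (by simp) hu.1, htr, one_div]
    simp [abs_of_nonneg (hu0 _)]
  have h := lpNorm_sum_le (s := Finset.univ) (fun i _ => hw i) (by rwa [ENNReal.one_le_ofReal])
  rw [hn _ (memLp_finsetSum' _ fun i _ => hw i)
    fun x => by rw [Finset.sum_apply]; exact Finset.sum_nonneg fun i _ => hw0 i x] at h
  simp_rw [hn _ (hw _) (hw0 _), Finset.sum_apply] at h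
  exact h

/-- Minkowski's inequality for mixed norms, with weight `α`: from `ℓ^s(L²)` to `L²(ℓ^s)`. -/
theorem sum_integral_sq_rpow_le {α : X → ℝ} (hα : ∀ x, 0 ≤ α x) {s : ℝ} (hs : 2 ≤ s)
    {u : ι → X → ℝ} (hu : ∀ i x, 0 ≤ u i x) (hui : ∀ i, Integrable (fun x => α x * u i x ^ 2) μ) :
    (∑ i, (∫ x, α x * u i x ^ 2 ∂μ) ^ (s / 2)) ^ (2 / s) ≤
      ∫ x, α x * (∑ i, u i x ^ s) ^ (2 / s) ∂μ := by
  have hs0 : 0 < s := two_pos.trans_le hs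
  have h := sum_integral_rpow_le_integral (t := s / 2) (by linarith) hui
    fun i x => mul_nonneg (hα x) (sq_nonneg _)
  have e : ∀ x, (∑ i, (α x * u i x ^ 2) ^ (s / 2)) ^ (1 / (s / 2)) =
      α x * (∑ i, u i x ^ s) ^ (2 / s) := by
    intro x
    have e1 : ∀ i, (α x * u i x ^ 2) ^ (s / 2) = α x ^ (s / 2) * u i x ^ s := by
      intro i
      rw [Real.mul_rpow (hα x) (sq_nonneg _), ← Real.rpow_natCast_mul (hu i x), Nat.cast_ofNat,
        mul_div_cancel₀ _ two_ne_zero]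
    simp_rw [e1]
    rw [← Finset.mul_sum, Real.mul_rpow (Real.rpow_nonneg (hα x) _)
      (Finset.sum_nonneg fun i _ => Real.rpow_nonneg (hu i x) _), ← Real.rpow_mul (hα x),
      mul_one_div_cancel (by positivity), Real.rpow_one, one_div_div]
  simp_rw [e] at h
  rwa [one_div_div] at h

/-- Minkowski's inequality for mixed norms, with weight `α`: from `L²(ℓ^r)` to `ℓ^r(L²)`. -/
theorem integral_sum_rpow_le_sum {α : X → ℝ} (hα : ∀ x, 0 ≤ α x) {r : ℝ} (hr0 : 0 < r)
    (hr : r ≤ 2) {u : ι → X → ℝ} (hu : ∀ i x, 0 ≤ u i x)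
    (hui : ∀ i, MemLp (fun x => α x ^ (r / 2) * u i x ^ r) (ENNReal.ofReal (2 / r)) μ) :
    ∫ x, α x * (∑ i, u i x ^ r) ^ (2 / r) ∂μ ≤
      (∑ i, (∫ x, α x * u i x ^ 2 ∂μ) ^ (r / 2)) ^ (2 / r) := by
  have h := integral_sum_rpow_le (t := 2 / r) ((one_le_div hr0).2 hr) hui
    fun i x => mul_nonneg (Real.rpow_nonneg (hα x) _) (Real.rpow_nonneg (hu i x) _)
  have e2 : r / 2 * (2 / r) = 1 := by field_simp
  have e3 : r * (2 / r) = (2 : ℕ) := by push_cast; field_simp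
  have e : ∀ x, ∀ b : ℝ, 0 ≤ b → (α x ^ (r / 2) * b) ^ (2 / r) = α x * b ^ (2 / r) := by
    intro x b hb
    rw [Real.mul_rpow (Real.rpow_nonneg (hα x) _) hb, ← Real.rpow_mul (hα x), e2, Real.rpow_one]
  have e5 : ∀ x, (∑ i, α x ^ (r / 2) * u i x ^ r) ^ (2 / r) =
      α x * (∑ i, u i x ^ r) ^ (2 / r) := by
    intro x
    rw [← Finset.mul_sum, e x _ (Finset.sum_nonneg fun i _ => Real.rpow_nonneg (hu i x) _)]
  have e6 : ∀ i x, (α x ^ (r / 2) * u i x ^ r) ^ (2 / r) = α x * u i x ^ 2 := by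
    intro i x
    rw [e x _ (Real.rpow_nonneg (hu i x) _), ← Real.rpow_mul (hu i x), e3, Real.rpow_natCast]
  simp_rw [e5, e6] at h
  rw [one_div_div] at h
  have hI : 0 ≤ ∫ x, α x * (∑ i, u i x ^ r) ^ (2 / r) ∂μ :=
    integral_nonneg fun x => mul_nonneg (hα x) (Real.rpow_nonneg
      (Finset.sum_nonneg fun i _ => Real.rpow_nonneg (hu i x) _) _)
  calc ∫ x, α x * (∑ i, u i x ^ r) ^ (2 / r) ∂μ
      = ((∫ x, α x * (∑ i, u i x ^ r) ^ (2 / r) ∂μ) ^ (r / 2)) ^ (2 / r) := by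
        rw [← Real.rpow_mul hI, e2, Real.rpow_one]
    _ ≤ _ := Real.rpow_le_rpow (Real.rpow_nonneg hI _) h (by positivity)

end Minkowski

section InducedSpace

variable {G : Type*} [Group G] [TopologicalSpace G] {Γ : Subgroup G} [MeasurableSpace G]
  [BorelSpace G] [IsTopologicalGroup G] [LocallyCompactSpace G]
  {E : Type*} [NormedAddCommGroup E] [NormedSpace ℂ E] {α : CutoffFunction Γ}
  {π : Γ →* (E →L[ℂ] E)}

theorem PreInduced.integrable_mul_sum_rpow {κ : Type*} [Fintype κ] (z : κ → PreInduced α π)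
    {b c : ℝ} (hb : 0 ≤ b) (hc : 0 ≤ c) :
    Integrable (fun h => α h * (∑ i, ‖z i h‖ ^ b) ^ c) (Measure.haar : Measure G) := by
  refine Continuous.integrable_of_hasCompactSupport (α.continuous_toFun.mul ?_)
    α.hasCompactSupport.mul_right
  refine Continuous.rpow_const (continuous_finsetSum _ fun i _ => ?_) fun _ => Or.inr hc
  exact (z i).continuous.norm.rpow_const fun _ => Or.inr hb

/-- `L²`-spaces inherit the bounds for matrices `ℓ^r → ℓ^s` with `r ≤ 2 ≤ s`. -/
theorem MatrixBound.preInduced {Ω ι : Type*} [Fintype Ω] [Fintype ι] {a : Ω → ι → ℝ}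
    {r s K : ℝ} (hK : 0 ≤ K) (hr0 : 0 < r) (hr : r ≤ 2) (hs : 2 ≤ s) (h : MatrixBound a r s K E) :
    MatrixBound a r s K (PreInduced α π) := by
  intro x
  have hs0 : 0 < s := two_pos.trans_le hs
  set μ : Measure G := Measure.haar
  have hα := α.continuous_toFun
  have hαs := α.hasCompactSupport
  set y : Ω → PreInduced α π := fun ω => ∑ i, ((a ω i : ℝ) : ℂ) • x i with hy
  have hyh : ∀ ω h, y ω h = ∑ i, ((a ω i : ℝ) : ℂ) • x i h := by
    intro ω h; simp only [hy, PreInduced.sum_apply, PreInduced.smul_apply]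
  have e : ∀ (f : PreInduced α π) (b : ℝ),
      ‖f‖ ^ b = (∫ h, α h * ‖f h‖ ^ 2 ∂μ) ^ (b / 2) := by
    intro f b
    rw [← f.norm_sq, ← Real.rpow_natCast_mul (norm_nonneg _), Nat.cast_ofNat,
      mul_div_cancel₀ _ two_ne_zero]
  -- Minkowski with exponent `s / 2` takes the integral out of the sum over `Ω`
  have h1 : (∑ ω, ‖y ω‖ ^ s) ^ (2 / s) ≤
      ∫ h, α h * (∑ ω, ‖y ω h‖ ^ s) ^ (2 / s) ∂μ := by
    simp_rw [e]
    exact sum_integral_sq_rpow_le α.nonneg hs (fun ω h => norm_nonneg (y ω h))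
      fun ω => (y ω).integrable_mul_norm_pow hα hαs 2
  -- and with exponent `2 / r` it takes the sum over `ι` out of the integral
  have h3 : ∫ h, α h * (∑ i, ‖x i h‖ ^ r) ^ (2 / r) ∂μ ≤ (∑ i, ‖x i‖ ^ r) ^ (2 / r) := by
    simp_rw [e]
    refine integral_sum_rpow_le_sum α.nonneg hr0 hr (fun i h => norm_nonneg (x i h)) fun i =>
      Continuous.memLp_of_hasCompactSupport ?_ ?_
    · exact (hα.rpow_const fun _ => Or.inr (by positivity)).mul
        ((x i).continuous.norm.rpow_const fun _ => Or.inr hr0.le)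
    · exact HasCompactSupport.mul_right (hαs.comp_left (g := fun b : ℝ => b ^ (r / 2))
        (Real.zero_rpow (by positivity)))
  have hcy : Integrable (fun h => α h * (∑ ω, ‖y ω h‖ ^ s) ^ (2 / s)) μ :=
    PreInduced.integrable_mul_sum_rpow y hs0.le (by positivity)
  have hcx : Integrable (fun h => α h * (∑ i, ‖x i h‖ ^ r) ^ (2 / r)) μ :=
    PreInduced.integrable_mul_sum_rpow x hr0.le (by positivity)
  have h2 : ∫ h, α h * (∑ ω, ‖y ω h‖ ^ s) ^ (2 / s) ∂μ ≤
      K ^ 2 * ∫ h, α h * (∑ i, ‖x i h‖ ^ r) ^ (2 / r) ∂μ := by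
    rw [← integral_const_mul]
    refine integral_mono hcy (hcx.const_mul _) fun g => ?_
    have hp := h fun i => x i g
    simp_rw [← hyh] at hp
    have hp2 := pow_le_pow_left₀ (by positivity) hp 2
    rw [mul_pow, ← Real.rpow_mul_natCast (by positivity), ← Real.rpow_mul_natCast (by positivity),
      Nat.cast_ofNat, one_div_mul_eq_div, one_div_mul_eq_div] at hp2
    calc α g * (∑ ω, ‖y ω g‖ ^ s) ^ (2 / s)
        ≤ α g * (K ^ 2 * (∑ i, ‖x i g‖ ^ r) ^ (2 / r)) :=
          mul_le_mul_of_nonneg_left hp2 (α.nonneg g)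
      _ = _ := by ring
  refine (pow_le_pow_iff_left₀ (by positivity) (by positivity) two_ne_zero).1 ?_
  rw [mul_pow, ← Real.rpow_mul_natCast (by positivity), ← Real.rpow_mul_natCast (by positivity),
    Nat.cast_ofNat, one_div_mul_eq_div, one_div_mul_eq_div]
  exact h1.trans (h2.trans (mul_le_mul_of_nonneg_left h3 (by positivity)))

/-- The induced representation space, the completion of `PreInduced α π`. -/
def InducedSpace (α : CutoffFunction Γ) (π : Γ →* (E →L[ℂ] E)) : Type _ :=
  UniformSpace.Completion (PreInduced α π)

namespace InducedSpace

noncomputable instance : NormedAddCommGroup (InducedSpace α π) :=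
  inferInstanceAs (NormedAddCommGroup (UniformSpace.Completion (PreInduced α π)))

noncomputable instance : NormedSpace ℂ (InducedSpace α π) :=
  inferInstanceAs (NormedSpace ℂ (UniformSpace.Completion (PreInduced α π)))

instance : CompleteSpace (InducedSpace α π) :=
  inferInstanceAs (CompleteSpace (UniformSpace.Completion (PreInduced α π)))

/-- The inclusion of the equivariant continuous maps. -/
noncomputable def of : PreInduced α π →ₗᵢ[ℂ] InducedSpace α π :=
  UniformSpace.Completion.toComplₗᵢ (E := PreInduced α π)

noncomputable instance : CoeTail (PreInduced α π) (InducedSpace α π) := ⟨of⟩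

theorem denseRange_of : DenseRange (of : PreInduced α π → InducedSpace α π) :=
  UniformSpace.Completion.denseRange_coe

@[elab_as_elim]
theorem induction_on {p : InducedSpace α π → Prop} (ξ : InducedSpace α π)
    (hp : IsClosed {ξ | p ξ}) (h : ∀ f : PreInduced α π, p f) : p ξ :=
  denseRange_of.induction_on ξ hp h

/-- The extension of a continuous linear map to the completion. -/
noncomputable def lift {F : Type*} [NormedAddCommGroup F] [NormedSpace ℂ F] [CompleteSpace F]
    (T : PreInduced α π →L[ℂ] F) : InducedSpace α π →L[ℂ] F :=
  T.extend of.toContinuousLinearMap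

@[simp] theorem lift_of {F : Type*} [NormedAddCommGroup F] [NormedSpace ℂ F] [CompleteSpace F]
    (T : PreInduced α π →L[ℂ] F) (f : PreInduced α π) : lift T (f : InducedSpace α π) = T f :=
  T.extend_eq (e := of.toContinuousLinearMap) denseRange_of of.isometry.isUniformInducing f

end InducedSpace

theorem MatrixBound.inducedSpace {Ω ι : Type*} [Fintype Ω] [Fintype ι] {a : Ω → ι → ℝ}
    {r s K : ℝ} (hK : 0 ≤ K) (hr0 : 0 < r) (hr : r ≤ 2) (hs : 2 ≤ s) (h : MatrixBound a r s K E) :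
    MatrixBound a r s K (InducedSpace α π) :=
  (h.preInduced hK hr0 hr hs).of_dense hr0 (by linarith) InducedSpace.of InducedSpace.denseRange_of

variable [T2Space G] [DiscreteTopology Γ]

/-- The induced representation: left translation on the induced space. -/
noncomputable def inducedHom (α : CutoffFunction Γ) (π : Γ →* (E →L[ℂ] E)) :
    G →* (InducedSpace α π →L[ℂ] InducedSpace α π) where
  toFun g := InducedSpace.lift (InducedSpace.of.toContinuousLinearMap.comp (PreInduced.translate g))
  map_one' := by
    ext x
    refine InducedSpace.induction_on x (isClosed_eq (by fun_prop) (by fun_prop)) fun f => ?_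
    rw [InducedSpace.lift_of]
    change ((PreInduced.translate 1 f : PreInduced α π) : InducedSpace α π) = f
    congr 1
    exact Subtype.ext (ContinuousMap.ext fun h => congrArg f (by simp))
  map_mul' g₁ g₂ := by
    ext x
    refine InducedSpace.induction_on x (isClosed_eq (by fun_prop) (by fun_prop)) fun f => ?_
    rw [mul_apply_eq_comp, InducedSpace.lift_of, InducedSpace.lift_of]
    refine Eq.trans ?_ (InducedSpace.lift_of _ (PreInduced.translate g₂ f)).symm
    change ((PreInduced.translate (g₁ * g₂) f : PreInduced α π) : InducedSpace α π) =
      (PreInduced.translate g₁ (PreInduced.translate g₂ f) : PreInduced α π)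
    congr 1
    exact Subtype.ext (ContinuousMap.ext fun h => congrArg f (by simp [mul_assoc]))

@[simp] theorem inducedHom_coe (g : G) (f : PreInduced α π) :
    inducedHom α π g (f : InducedSpace α π) = (PreInduced.translate g f : PreInduced α π) :=
  InducedSpace.lift_of _ _

theorem norm_inducedHom_le (g : G) {M : ℝ} (hM0 : 0 ≤ M)
    (hM : ∀ (y : G) (γ : Γ), α y ≠ 0 → α (g * y * γ) ≠ 0 → ‖π γ⁻¹‖ ≤ M) :
    ‖inducedHom α π g‖ ≤ M := by
  refine ContinuousLinearMap.opNorm_le_bound _ hM0 fun x => ?_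
  refine InducedSpace.induction_on x (isClosed_le (by fun_prop) (by fun_prop)) fun f => ?_
  rw [inducedHom_coe, LinearIsometry.norm_map, LinearIsometry.norm_map]
  exact PreInduced.norm_translateₗ_le g hM0 hM f

/-- A locally bounded family of operators which is strongly continuous on a dense subset is
strongly continuous. -/
theorem continuous_apply_of_dense {X F : Type*} [TopologicalSpace X] [NormedAddCommGroup F]
    [NormedSpace ℂ F] {T : X → F →L[ℂ] F} {c : X → ℝ} (hc : Continuous c)
    (hT : ∀ g, ‖T g‖ ≤ c g) {D : Set F} (hD : Dense D)
    (h : ∀ y ∈ D, Continuous fun g => T g y) (x : F) : Continuous fun g => T g x := by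
  rw [continuous_iff_continuousAt]
  intro g₀
  refine continuousAt_of_locally_uniform_approx_of_continuousAt fun u hu => ?_
  obtain ⟨ε, hε, hεu⟩ := Metric.mem_uniformity_dist.1 hu
  have hC : 0 < |c g₀| + 1 := by positivity
  obtain ⟨y, hy, hxy⟩ := Metric.dense_iff.1 hD x (ε / (|c g₀| + 1)) (by positivity)
  refine ⟨{g | c g < |c g₀| + 1}, ?_, fun g => T g y, (h y hxy).continuousAt, fun g hg => ?_⟩
  · exact (isOpen_lt hc continuous_const).mem_nhds
      (show c g₀ < |c g₀| + 1 from (le_abs_self _).trans_lt (lt_add_one _))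
  · refine hεu ?_
    rw [dist_eq_norm, ← map_sub]
    rw [Metric.mem_ball, dist_comm, dist_eq_norm] at hy
    calc ‖T g (x - y)‖ ≤ ‖T g‖ * ‖x - y‖ := (T g).le_opNorm _
      _ ≤ (|c g₀| + 1) * ‖x - y‖ :=
          mul_le_mul_of_nonneg_right ((hT g).trans (le_of_lt hg)) (norm_nonneg _)
      _ < (|c g₀| + 1) * (ε / (|c g₀| + 1)) := by gcongr
      _ = ε := by field_simp

end InducedSpace

section InducedRep

variable {G : Type u} [Group G] [TopologicalSpace G] {Γ : Subgroup G}

/-- The length `m'` on `G` dominates the length `m` on `Γ` where this matters for the induction of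
representations with the cutoff function `α`. -/
def LengthDominates (α : CutoffFunction Γ) (m : GroupLength Γ) (m' : GroupLength G) : Prop :=
  ∀ (g y : G) (γ : Γ), α y ≠ 0 → α (g * y * γ) ≠ 0 → m γ ≤ m' g

theorem BanachRep.norm_inv_le {𝓔 : Set BanachSp.{v}} {m : GroupLength Γ} {m' : GroupLength G}
    {α : CutoffFunction Γ} (hm : LengthDominates α m m') (r : BanachRep 𝓔 m) {g y : G} {γ : Γ}
    (hy : α y ≠ 0) (hγ : α (g * y * γ) ≠ 0) : ‖r.π γ⁻¹‖ ≤ Real.exp (m' g) := by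
  refine (r.norm_le _).trans (Real.exp_le_exp.2 ?_)
  rw [m.map_inv]
  exact_mod_cast hm g y γ hy hγ

variable [MeasurableSpace G]
  [BorelSpace G] [IsTopologicalGroup G] [LocallyCompactSpace G] [T2Space G] [DiscreteTopology Γ]

/-- The induced representation, as a member of a class given by type conditions. -/
noncomputable def BanachRep.induced {𝓔 : Set BanachSp.{max u v}} {m : GroupLength Γ}
    {m' : GroupLength G} {α : CutoffFunction Γ} (hm : LengthDominates α m m') {q T : ℝ}
    (hq1 : 1 < q) (hq2 : q ≤ 2) (hT : 0 ≤ T) (h𝓔 : 𝓔 ⊆ typeDualTypeClass q T)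
    (r : BanachRep 𝓔 m) : BanachRep (typeDualTypeClass.{max u v} q T) m' where
  E := ⟨InducedSpace α r.π⟩
  mem n := by
    have hq : (2 : ℝ) ≤ q.conjExponent := by
      rw [Real.conjExponent, le_div_iff₀ (by linarith)]; linarith
    exact ⟨(h𝓔 r.mem n).1.inducedSpace (by positivity) (by linarith) hq2 le_rfl,
      (h𝓔 r.mem n).2.inducedSpace (by positivity) two_pos le_rfl hq⟩
  π := inducedHom α r.π
  continuous_orbit x := by
    refine continuous_apply_of_dense (c := fun g => Real.exp (m' g))
      (Real.continuous_exp.comp (NNReal.continuous_coe.comp m'.continuous_toFun))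
      (fun g => norm_inducedHom_le g (Real.exp_nonneg _) fun y γ => r.norm_inv_le hm)
      (D := Set.range (InducedSpace.of : PreInduced α r.π → InducedSpace α r.π))
      InducedSpace.denseRange_of ?_ x
    rintro _ ⟨f, rfl⟩
    simp_rw [inducedHom_coe]
    exact InducedSpace.of.continuous.comp f.continuous_translate
  norm_le g := norm_inducedHom_le g (Real.exp_nonneg _) fun y γ => r.norm_inv_le hm

end InducedRep

/-! ### Averages of equivariant maps -/

section Average

variable {G : Type*} [Group G] [TopologicalSpace G] {Γ : Subgroup G}
  {E : Type*} [NormedAddCommGroup E] [NormedSpace ℂ E] {α : CutoffFunction Γ}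
  {π : Γ →* (E →L[ℂ] E)}

/-- A cutoff function as an element of `C_c(G)`. -/
def CutoffFunction.toCc (α : CutoffFunction Γ) : C_c(G, ℝ) :=
  ⟨⟨α, α.continuous_toFun⟩, α.hasCompactSupport⟩

@[simp] theorem CutoffFunction.toCc_apply (α : CutoffFunction Γ) (h : G) : α.toCc h = α h := rfl

theorem CompactlySupportedContinuousMap.exists_abs_le {X : Type*}
    [TopologicalSpace X] (β : C_c(X, ℝ)) :
    ∃ b : ℝ, ∀ h, |β h| ≤ b := by
  obtain ⟨b, hb⟩ := β.hasCompactSupport.exists_bound_of_continuous (map_continuous β)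
  exact ⟨b, hb⟩

variable [IsTopologicalGroup G]

theorem CutoffFunction.isCompact_image2 (α : CutoffFunction Γ) {Q : Set G} (hQ : IsCompact Q) :
    IsCompact ((fun z : G × G => z.1⁻¹ * z.2) '' (Q ×ˢ α.supp)) :=
  (hQ.prod α.isCompact_supp).image (by fun_prop)

section Spread

variable [T2Space G] [DiscreteTopology Γ]

namespace PreInduced

theorem finite_support_spread (x : E) (h : G) :
    (Function.support fun γ : Γ => (α (h * γ) : ℂ) • π γ x).Finite :=
  (α.finite_support h).subset fun γ hγ h0 => hγ (by simp [h0])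

variable [LocallyCompactSpace G]

/-- The equivariant map `h ↦ ∑ α(h γ) π(γ) x`. -/
noncomputable def spread (α : CutoffFunction Γ) (π : Γ →* (E →L[ℂ] E)) (x : E) :
    PreInduced α π :=
  mk (fun h => ∑ᶠ γ : Γ, (α (h * γ) : ℂ) • π γ x)
    (by
      refine continuous_finsum_of_mul_mem Γ α.isCompact_supp
        (F := fun γ h => (α (h * γ) : ℂ) • π γ x) (fun γ => ?_) fun γ h hh => ?_
      · exact (Complex.continuous_ofReal.comp
          (α.continuous_toFun.comp (continuous_mul_const _))).smul continuous_const
      · exact α.mem_supp fun h0 => hh (by simp [h0]))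
    (fun h δ => by
      change _ = (π δ⁻¹ : E →ₗ[ℂ] E) _
      rw [map_finsum _ (finite_support_spread x h), ← finsum_comp_equiv (Equiv.mulLeft δ⁻¹)]
      refine finsum_congr fun γ => ?_
      simp [mul_assoc])

theorem spread_apply_eq_sum (x : E) {Q : Set G} (hQ : IsCompact Q) {h : G} (hh : h ∈ Q) :
    spread α π x h = ∑ γ ∈ α.translates hQ, (α (h * γ) : ℂ) • π γ x :=
  finsum_eq_sum_of_support_subset _ fun γ hγ =>
    α.mem_translates hQ hh fun h0 => hγ (by simp [h0])

end PreInduced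

end Spread

variable [MeasurableSpace G] [BorelSpace G] [LocallyCompactSpace G]

/-- The matrix coefficient `∫ α(h) α(g⁻¹ h γ) dh`. -/
noncomputable def CutoffFunction.coeff (α : CutoffFunction Γ) (γ : Γ) (g : G) : ℝ :=
  ∫ h : G, α h * α (g⁻¹ * h * γ) ∂Measure.haar

theorem CutoffFunction.continuous_coeff (α : CutoffFunction Γ) (γ : Γ) : Continuous (α.coeff γ) := by
  rw [← continuousOn_univ]
  refine continuousOn_integral_of_compact_support α.isCompact_supp ?_ ?_
  · refine Continuous.continuousOn ?_
    have := α.continuous_toFun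
    unfold Function.uncurry
    fun_prop
  · intro g h _ hh
    rw [image_eq_zero_of_notMem_tsupport hh, zero_mul]

namespace PreInduced

theorem integrable_smul (β : C_c(G, ℝ)) (f : PreInduced α π) :
    Integrable (fun h => (β h : ℂ) • f h) (Measure.haar : Measure G) := by
  refine Continuous.integrable_of_hasCompactSupport ?_ ?_
  · exact (Complex.continuous_ofReal.comp (map_continuous β)).smul f.continuous
  · exact (β.hasCompactSupport.comp_left (g := Complex.ofReal) Complex.ofReal_zero).smul_right

/-- The weighted average `f ↦ ∫ β(h) f(h) dh`. -/
noncomputable def averageₗ (β : C_c(G, ℝ)) : PreInduced α π →ₗ[ℂ] E where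
  toFun f := ∫ h : G, (β h : ℂ) • f h ∂Measure.haar
  map_add' f g := by
    rw [← integral_add (f.integrable_smul β) (g.integrable_smul β)]
    simp
  map_smul' c f := by
    rw [RingHom.id_apply, ← integral_smul]
    congr 1; ext h
    rw [smul_apply, smul_comm]

theorem averageₗ_apply (β : C_c(G, ℝ)) (f : PreInduced α π) :
    averageₗ β f = ∫ h : G, (β h : ℂ) • f h ∂Measure.haar := rfl

variable [T2Space G] [DiscreteTopology Γ]

theorem norm_averageₗ_le (β : C_c(G, ℝ)) {C : ℝ} (hC0 : 0 ≤ C)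
    (hC : ∀ h, α h ≠ 0 → ∑ᶠ γ : Γ, |β (h * γ)| * ‖π γ⁻¹‖ ≤ C) (f : PreInduced α π) :
    ‖averageₗ β f‖ ≤ C * √(∫ h : G, α h ∂Measure.haar) * ‖f‖ := by
  rw [averageₗ_apply]
  calc ‖∫ h : G, (β h : ℂ) • f h ∂Measure.haar‖
      ≤ ∫ h : G, |β h| * ‖f h‖ ^ 1 ∂Measure.haar := by
        refine (norm_integral_le_integral_norm _).trans_eq ?_
        congr 1; ext h
        rw [norm_smul, Complex.norm_real, pow_one, Real.norm_eq_abs]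
    _ ≤ C * ∫ h : G, α h * ‖f h‖ ^ 1 ∂Measure.haar :=
        f.integral_mul_norm_pow_le (map_continuous β).abs β.hasCompactSupport.abs
          (fun _ => abs_nonneg _) 1 (by simpa using hC)
    _ ≤ C * (√(∫ h : G, α h ∂Measure.haar) * ‖f‖) := by
        simp only [pow_one]
        exact mul_le_mul_of_nonneg_left f.integral_mul_norm_le hC0
    _ = _ := by ring

/-- For functions supported in a fixed compact set, averages are controlled by the supremum. -/
theorem exists_norm_averageₗ_le (α : CutoffFunction Γ) (π : Γ →* (E →L[ℂ] E)) {Q : Set G}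
    (hQ : IsCompact Q) : ∃ C : ℝ, 0 ≤ C ∧ ∀ (β : C_c(G, ℝ)) (b : ℝ),
      (∀ h, |β h| ≤ b) → (∀ h ∉ Q, β h = 0) → ∀ f : PreInduced α π,
        ‖averageₗ β f‖ ≤ b * C * ‖f‖ := by
  set S : Finset Γ := (Γ.finite_setOf_mul_mem α.isCompact_supp hQ).toFinset with hS
  refine ⟨(∑ γ ∈ S, ‖π γ⁻¹‖) * √(∫ h : G, α h ∂Measure.haar), by positivity,
    fun β b hb hβ f => ?_⟩
  have hb0 : 0 ≤ b := (abs_nonneg _).trans (hb 1)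
  rw [← mul_assoc]
  refine norm_averageₗ_le β (by positivity) (fun h hh => ?_) f
  rw [finsum_eq_sum_of_support_subset (s := S), Finset.mul_sum]
  · exact Finset.sum_le_sum fun γ _ => mul_le_mul_of_nonneg_right (hb _) (norm_nonneg _)
  · intro γ hγ
    have h1 : β (h * γ) ≠ 0 := by simpa using left_ne_zero_of_mul hγ
    rw [hS, Set.Finite.coe_toFinset]
    exact ⟨h, α.mem_supp hh, by_contra fun h2 => h1 (hβ _ h2)⟩

/-- The weighted average as a continuous linear map. -/
noncomputable def average (β : C_c(G, ℝ)) : PreInduced α π →L[ℂ] E :=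
  LinearMap.mkContinuousOfExistsBound (averageₗ β) <|
    let ⟨C, _, hC⟩ := exists_norm_averageₗ_le α π β.hasCompactSupport
    let ⟨b, hb⟩ := β.exists_abs_le
    ⟨b * C, hC β b hb fun _ hh => image_eq_zero_of_notMem_tsupport hh⟩

theorem average_apply (β : C_c(G, ℝ)) (f : PreInduced α π) :
    average β f = ∫ h : G, (β h : ℂ) • f h ∂Measure.haar := rfl

theorem norm_spread_le {M : ℝ} (hM0 : 0 ≤ M)
    (hM : ∀ (y : G) (γ : Γ), α y ≠ 0 → α (1 * y * γ) ≠ 0 → ‖π γ⁻¹‖ ≤ M) (x : E) :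
    ‖spread α π x‖ ≤ M * √(∫ h : G, α h ∂Measure.haar) * ‖x‖ := by
  have h0 : 0 ≤ ∫ h : G, α h ∂Measure.haar := integral_nonneg α.nonneg
  refine (pow_le_pow_iff_left₀ (norm_nonneg _) (by positivity) two_ne_zero).1 ?_
  rw [norm_sq, mul_pow, mul_pow, Real.sq_sqrt h0, mul_right_comm, mul_comm, ← integral_mul_const]
  refine integral_mono
    ((spread α π x).integrable_mul_norm_pow α.continuous_toFun α.hasCompactSupport 2)
    ((α.continuous_toFun.integrable_of_hasCompactSupport α.hasCompactSupport).mul_const _)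
    fun h => ?_
  simp only
  by_cases hh : α h = 0
  · simp [hh]
  rw [← mul_pow]
  refine mul_le_mul_of_nonneg_left (pow_le_pow_left₀ (norm_nonneg _) ?_ 2) (α.nonneg h)
  rw [spread_apply_eq_sum x isCompact_singleton (Set.mem_singleton h)]
  calc ‖∑ γ ∈ α.translates (isCompact_singleton (x := h)), (α (h * γ) : ℂ) • π γ x‖
      ≤ ∑ γ ∈ α.translates (isCompact_singleton (x := h)), α (h * γ) * (M * ‖x‖) := by
        refine norm_sum_le_of_le _ fun γ _ => ?_
        rw [norm_smul, Complex.norm_real, Real.norm_of_nonneg (α.nonneg _)]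
        by_cases h1 : α (h * γ) = 0
        · simp [h1]
        · have h2 : ‖π γ‖ ≤ M := by
            simpa using hM (h * γ) γ⁻¹ h1 (by simpa using hh)
          exact mul_le_mul_of_nonneg_left (((π γ).le_opNorm x).trans
            (mul_le_mul_of_nonneg_right h2 (norm_nonneg x))) (α.nonneg _)
    _ = M * ‖x‖ := by
        rw [← Finset.sum_mul, α.sum_translates _ (Set.mem_singleton h), one_mul]

/-- `spread` as a linear map. -/
noncomputable def spreadₗ (α : CutoffFunction Γ) (π : Γ →* (E →L[ℂ] E)) :
    E →ₗ[ℂ] PreInduced α π where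
  toFun := spread α π
  map_add' x y := Subtype.ext <| ContinuousMap.ext fun h => by
    change ∑ᶠ γ : Γ, (α (h * γ) : ℂ) • π γ (x + y) = (∑ᶠ γ : Γ, (α (h * γ) : ℂ) • π γ x) +
      ∑ᶠ γ : Γ, (α (h * γ) : ℂ) • π γ y
    rw [← finsum_add_distrib (finite_support_spread x h) (finite_support_spread y h)]
    simp
  map_smul' c x := Subtype.ext <| ContinuousMap.ext fun h => by
    change ∑ᶠ γ : Γ, (α (h * γ) : ℂ) • π γ (c • x) = c • ∑ᶠ γ : Γ, (α (h * γ) : ℂ) • π γ x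
    rw [smul_finsum' _ (finite_support_spread x h)]
    simp [smul_comm c]

/-- The map `x ↦ ∑ α(h γ) π(γ) x` as a continuous linear map. -/
noncomputable def spreadL (α : CutoffFunction Γ) (π : Γ →* (E →L[ℂ] E)) :
    E →L[ℂ] PreInduced α π :=
  LinearMap.mkContinuousOfExistsBound (spreadₗ α π) <|
    let ⟨M, hM0, hM⟩ := exists_norm_le π α 1
    ⟨M * √(∫ h : G, α h ∂Measure.haar), norm_spread_le hM0 hM⟩

theorem norm_average_cutoff_le {M : ℝ} (hM0 : 0 ≤ M)
    (hM : ∀ (y : G) (γ : Γ), α y ≠ 0 → α (1 * y * γ) ≠ 0 → ‖π γ⁻¹‖ ≤ M) :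
    ‖(average α.toCc : PreInduced α π →L[ℂ] E)‖ ≤ M * √(∫ h : G, α h ∂Measure.haar) := by
  refine ContinuousLinearMap.opNorm_le_bound _ (by positivity)
    (norm_averageₗ_le _ hM0 fun h hh => ?_)
  calc ∑ᶠ γ : Γ, |α.toCc (h * γ)| * ‖π γ⁻¹‖ ≤ ∑ᶠ γ : Γ, α (h * γ) * M := by
        refine finsum_le_finsum' ?_ ?_ fun γ => ?_
        · exact (α.finite_support h).subset fun γ hγ h0 => hγ (by simp [h0])
        · exact (α.finite_support h).subset fun γ hγ h0 => hγ (by simp [h0])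
        · simp only [CutoffFunction.toCc_apply, abs_of_nonneg (α.nonneg _)]
          by_cases h1 : α (h * γ) = 0
          · simp [h1]
          · exact mul_le_mul_of_nonneg_left (hM h γ hh (by simpa using h1)) (α.nonneg _)
    _ = M := by rw [← finsum_mul' _ _ (α.finite_support h), α.finsum_eq_one, one_mul]

end PreInduced

variable [T2Space G] [DiscreteTopology Γ]

namespace CutoffFunction

theorem coeff_eq_zero (α : CutoffFunction Γ) {Q : Set G} (hQ : IsCompact Q) {g : G} (hg : g ∈ Q)
    {γ : Γ} (hγ : γ ∉ α.translates (α.isCompact_image2 hQ)) : α.coeff γ g = 0 := by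
  rw [coeff, ← integral_zero G ℝ (μ := Measure.haar)]
  congr 1; ext h
  by_contra hh
  have hm : g⁻¹ * h ∈ (fun z : G × G => z.1⁻¹ * z.2) '' (Q ×ˢ α.supp) :=
    ⟨(g, h), ⟨hg, α.mem_supp (left_ne_zero_of_mul hh)⟩, rfl⟩
  exact hγ (α.mem_translates _ hm (right_ne_zero_of_mul hh))

/-- This symmetry rests on the unimodularity of `G`. -/
theorem coeff_inv (α : CutoffFunction Γ) (γ : Γ) (g : G) :
    α.coeff γ⁻¹ g⁻¹ = α.coeff γ g := by
  have := α.isMulRightInvariant_haar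
  rw [coeff, coeff]
  rw [← integral_mul_right_eq_self (μ := (Measure.haar : Measure G)) _ (γ : G),
    ← integral_mul_left_eq_self (μ := (Measure.haar : Measure G)) _ g⁻¹]
  congr 1; ext h
  simp [mul_assoc, mul_comm]

end CutoffFunction

/-- The compression of a translation is a combination of the operators `π(γ)` with the matrix
coefficients `α.coeff γ`. -/
theorem PreInduced.average_translate_spread [CompleteSpace E] {Q : Set G} (hQ : IsCompact Q)
    {g : G} (hg : g ∈ Q) (x : E) :
    average α.toCc (translate g (spread α π x)) =
      ∑ γ ∈ α.translates (α.isCompact_image2 hQ), (α.coeff γ g : ℂ) • π γ x := by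
  set S := α.translates (α.isCompact_image2 hQ)
  have h1 : ∀ h, (α.toCc h : ℂ) • translate g (spread α π x) h =
      ∑ γ ∈ S, (α h : ℂ) • (α (g⁻¹ * h * γ) : ℂ) • π γ x := by
    intro h
    rw [← Finset.smul_sum]
    by_cases hh : α h = 0
    · simp [hh]
    · rw [translate_apply, spread_apply_eq_sum x (α.isCompact_image2 hQ)
        ⟨(g, h), ⟨hg, α.mem_supp hh⟩, rfl⟩]
      rfl
  rw [average_apply]
  simp_rw [h1]
  have hc := α.continuous_toFun
  rw [integral_finsetSum]
  · refine Finset.sum_congr rfl fun γ _ => ?_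
    simp_rw [smul_smul, ← Complex.ofReal_mul]
    rw [integral_smul_const, integral_complex_ofReal]
    rfl
  · intro γ _
    simp_rw [smul_smul, ← Complex.ofReal_mul]
    refine Integrable.smul_const (Integrable.ofReal ?_) _
    exact (hc.mul (hc.comp (by fun_prop))).integrable_of_hasCompactSupport
      α.hasCompactSupport.mul_right

end Average

/-! ### Averages of invariant vectors -/

section ApproximateIdentity

open scoped Pointwise

variable {G : Type*} [Group G] [TopologicalSpace G] [IsTopologicalGroup G]

/-- The right translate `h ↦ β (h g)`. -/
def rightTranslate (β : C_c(G, ℝ)) (g : G) : C_c(G, ℝ) :=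
  ⟨⟨fun h => β (h * g), (map_continuous β).comp (continuous_mul_const g)⟩,
    β.hasCompactSupport.comp_homeomorph (Homeomorph.mulRight g)⟩

@[simp] theorem rightTranslate_apply (β : C_c(G, ℝ)) (g h : G) :
    rightTranslate β g h = β (h * g) := rfl

/-- The function `g ↦ β (g⁻¹)`, with complex values. -/
noncomputable def reflect (β : C_c(G, ℝ)) : C_c(G, ℂ) :=
  ⟨⟨fun g => (β g⁻¹ : ℂ), Complex.continuous_ofReal.comp
    ((map_continuous β).comp continuous_inv)⟩,
    (β.hasCompactSupport.comp_homeomorph (Homeomorph.inv G)).comp_left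
      (g := Complex.ofReal) Complex.ofReal_zero⟩

@[simp] theorem reflect_apply (β : C_c(G, ℝ)) (g : G) : reflect β g = (β g⁻¹ : ℂ) := rfl

/-- Uniform continuity of a function of compact support, with respect to right translations. -/
theorem exists_nhds_one_abs_sub_le [LocallyCompactSpace G] (β : C_c(G, ℝ)) {ε : ℝ} (hε : 0 < ε) :
    ∃ U ∈ 𝓝 (1 : G), ∀ g ∈ U, ∀ h, |β (h * g⁻¹) - β h| ≤ ε := by
  obtain ⟨N, hN, hN1⟩ := exists_compact_mem_nhds (1 : G)
  have hβ := map_continuous β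
  have hQ : IsCompact (tsupport β * N ∪ tsupport β) :=
    (β.hasCompactSupport.isCompact.mul hN).union β.hasCompactSupport.isCompact
  obtain ⟨U, hU, hUk⟩ := hQ.mem_uniformity_of_prod (f := fun g h : G => β (h * g⁻¹))
    (s := Set.univ) (Continuous.continuousOn (by unfold Function.uncurry; fun_prop))
    (Set.mem_univ (1 : G)) (Metric.dist_mem_uniformity hε)
  rw [nhdsWithin_univ] at hU
  refine ⟨U ∩ N, Filter.inter_mem hU hN1, fun g hg h => ?_⟩
  by_cases hh : h ∈ tsupport β * N ∪ tsupport β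
  · have := hUk g hg.1 h hh
    simp only [inv_one, mul_one, Set.mem_ofPred_eq, Real.dist_eq] at this
    exact this.le
  · rw [image_eq_zero_of_notMem_tsupport (f := β) fun h1 => hh (Or.inr h1),
      image_eq_zero_of_notMem_tsupport (f := β) fun h1 => hh (Or.inl ⟨_, h1, g, hg.2, by simp⟩)]
    simpa using hε.le

variable [LocallyCompactSpace G] [MeasurableSpace G] [BorelSpace G]

/-- The average `h ↦ ∫ φ(g) β(h g⁻¹) dg` of right translates of `β`. -/
noncomputable def smear (φ β : C_c(G, ℝ)) : C_c(G, ℝ) where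
  toFun h := ∫ g : G, φ g * β (h * g⁻¹) ∂Measure.haar
  continuous_toFun := by
    rw [← continuousOn_univ]
    refine continuousOn_integral_of_compact_support φ.hasCompactSupport ?_ ?_
    · refine Continuous.continuousOn ?_
      have := map_continuous φ
      have := map_continuous β
      unfold Function.uncurry
      fun_prop
    · intro g h _ hh
      rw [image_eq_zero_of_notMem_tsupport hh, zero_mul]
  hasCompactSupport' := by
    refine HasCompactSupport.intro
      (β.hasCompactSupport.isCompact.mul φ.hasCompactSupport.isCompact) fun h hh => ?_
    rw [← integral_zero G ℝ (μ := Measure.haar)]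
    congr 1; ext g
    by_contra h0
    exact hh ⟨h * g⁻¹, subset_tsupport _ (right_ne_zero_of_mul h0), g,
      subset_tsupport _ (left_ne_zero_of_mul h0), by simp⟩

theorem smear_apply (φ β : C_c(G, ℝ)) (h : G) :
    smear φ β h = ∫ g : G, φ g * β (h * g⁻¹) ∂Measure.haar := rfl

theorem smear_eq_zero {φ β : C_c(G, ℝ)} {N : Set G} (hφ : ∀ g ∉ N, φ g = 0) {h : G}
    (hh : h ∉ tsupport β * N) : smear φ β h = 0 := by
  rw [smear_apply, ← integral_zero G ℝ (μ := Measure.haar)]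
  congr 1; ext g
  by_contra h0
  exact hh ⟨h * g⁻¹, subset_tsupport _ (right_ne_zero_of_mul h0), g,
    by_contra fun h1 => left_ne_zero_of_mul h0 (hφ g h1), by simp⟩

theorem abs_smear_sub_le {φ β : C_c(G, ℝ)} (hφ0 : ∀ g, 0 ≤ φ g)
    (hφ1 : ∫ g : G, φ g ∂Measure.haar = 1) {ε : ℝ}
    (hε : ∀ g, φ g ≠ 0 → ∀ h, |β (h * g⁻¹) - β h| ≤ ε) (h : G) :
    |smear φ β h - β h| ≤ ε := by
  have hφc := map_continuous φ
  have hβc := map_continuous β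
  have hφi : Integrable φ (Measure.haar : Measure G) :=
    hφc.integrable_of_hasCompactSupport φ.hasCompactSupport
  have hi : Integrable (fun g => φ g * β (h * g⁻¹)) (Measure.haar : Measure G) :=
    Continuous.integrable_of_hasCompactSupport (by fun_prop) φ.hasCompactSupport.mul_right
  have e : smear φ β h - β h = ∫ g : G, φ g * (β (h * g⁻¹) - β h) ∂Measure.haar := by
    simp_rw [mul_sub]
    rw [integral_sub hi (hφi.mul_const _), integral_mul_const, hφ1, one_mul, smear_apply]
  have e' : ∫ g : G, φ g * ε ∂Measure.haar = ε := by rw [integral_mul_const, hφ1, one_mul]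
  rw [e, ← Real.norm_eq_abs]
  refine (norm_integral_le_of_norm_le (hφi.mul_const ε)
    (Filter.Eventually.of_forall fun g => ?_)).trans_eq e'
  rw [norm_mul, Real.norm_of_nonneg (hφ0 g)]
  by_cases h0 : φ g = 0
  · simp [h0]
  · exact mul_le_mul_of_nonneg_left (hε g h0 h) (hφ0 g)

theorem exists_approximate_identity [T2Space G] {U : Set G} (hU : U ∈ 𝓝 (1 : G)) :
    ∃ φ : C_c(G, ℝ), (∀ g, 0 ≤ φ g) ∧ (∀ g ∉ U, φ g = 0) ∧
      ∫ g : G, φ g ∂Measure.haar = 1 := by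
  obtain ⟨f, hf1, hf0, hfc, hf01⟩ := exists_continuous_one_zero_of_isCompact
    (isCompact_singleton (x := (1 : G))) (isOpen_interior (s := U)).isClosed_compl
    (Set.disjoint_singleton_left.2 fun h => h (mem_interior_iff_mem_nhds.2 hU))
  have hpos : 0 < ∫ g : G, f g ∂Measure.haar :=
    f.continuous.integral_pos_of_hasCompactSupport_nonneg_nonzero hfc (fun g => (hf01 g).1)
      (x := 1) (by rw [hf1 rfl]; exact one_ne_zero)
  refine ⟨(∫ g : G, f g ∂Measure.haar)⁻¹ • ⟨f, hfc⟩, fun g => ?_, fun g hg => ?_, ?_⟩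
  · exact mul_nonneg (inv_nonneg.2 hpos.le) (hf01 g).1
  · change _ * f g = 0
    rw [hf0 fun h => hg (interior_subset h)]
    simp
  · change ∫ g : G, (∫ g : G, f g ∂Measure.haar)⁻¹ * f g ∂Measure.haar = 1
    rw [integral_const_mul, inv_mul_cancel₀ hpos.ne']

end ApproximateIdentity

section AverageInduced

open scoped Pointwise

variable {G : Type*} [Group G] [TopologicalSpace G] {Γ : Subgroup G} [MeasurableSpace G]
  [BorelSpace G] [IsTopologicalGroup G] [LocallyCompactSpace G]
  {E : Type*} [NormedAddCommGroup E] [NormedSpace ℂ E] [CompleteSpace E] {α : CutoffFunction Γ}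
  {π : Γ →* (E →L[ℂ] E)} [T2Space G] [DiscreteTopology Γ]

/-- The weighted average `f ↦ ∫ β(h) f(h) dh` on the induced space. -/
noncomputable def averageInduced (β : C_c(G, ℝ)) : InducedSpace α π →L[ℂ] E :=
  InducedSpace.lift (PreInduced.average β)

@[simp] theorem averageInduced_coe (β : C_c(G, ℝ)) (f : PreInduced α π) :
    averageInduced β (f : InducedSpace α π) = PreInduced.average β f :=
  InducedSpace.lift_of _ _

theorem averageInduced_sub (β₁ β₂ : C_c(G, ℝ)) (ξ : InducedSpace α π) :
    averageInduced (β₁ - β₂) ξ = averageInduced β₁ ξ - averageInduced β₂ ξ := by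
  refine InducedSpace.induction_on ξ (isClosed_eq (by fun_prop) (by fun_prop))
    fun f => ?_
  simp only [averageInduced_coe, PreInduced.average_apply]
  rw [← integral_sub (f.integrable_smul β₁) (f.integrable_smul β₂)]
  simp [sub_smul]

theorem exists_norm_averageInduced_le (α : CutoffFunction Γ) (π : Γ →* (E →L[ℂ] E)) {Q : Set G}
    (hQ : IsCompact Q) : ∃ C : ℝ, 0 ≤ C ∧ ∀ (β : C_c(G, ℝ)) (b : ℝ),
      (∀ h, |β h| ≤ b) → (∀ h ∉ Q, β h = 0) → ∀ ξ : InducedSpace α π,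
        ‖averageInduced β ξ‖ ≤ b * C * ‖ξ‖ := by
  obtain ⟨C, hC0, hC⟩ := PreInduced.exists_norm_averageₗ_le α π hQ
  refine ⟨C, hC0, fun β b hb hβ ξ => ?_⟩
  refine InducedSpace.induction_on ξ (isClosed_le (by fun_prop) (by fun_prop))
    fun f => ?_
  rw [averageInduced_coe, LinearIsometry.norm_map]
  exact hC β b hb hβ f

/-- Translating the weight by `γ` on the right amounts to applying `π(γ)`. -/
theorem map_averageInduced (γ : Γ) (β : C_c(G, ℝ)) (ξ : InducedSpace α π) :
    π γ (averageInduced β ξ) = averageInduced (rightTranslate β γ) ξ := by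
  have := α.isMulRightInvariant_haar
  refine InducedSpace.induction_on ξ (isClosed_eq (by fun_prop) (by fun_prop))
    fun f => ?_
  simp only [averageInduced_coe, PreInduced.average_apply]
  rw [← ContinuousLinearMap.integral_comp_comm _ (f.integrable_smul β),
    ← integral_mul_right_eq_self (μ := (Measure.haar : Measure G)) _ (γ : G)]
  congr 1; ext h
  rw [map_smul, f.apply_mul, ← mul_apply_eq_comp, ← map_mul]
  simp

/-- Averages with smeared weights approximate the average. -/
theorem exists_norm_averageInduced_smear_sub_le (β : C_c(G, ℝ)) (ξ : InducedSpace α π) {ε : ℝ}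
    (hε : 0 < ε) : ∃ U ∈ 𝓝 (1 : G), ∀ φ : C_c(G, ℝ), (∀ g, 0 ≤ φ g) → (∀ g ∉ U, φ g = 0) →
      ∫ g : G, φ g ∂Measure.haar = 1 →
      ‖averageInduced (smear φ β) ξ - averageInduced β ξ‖ ≤ ε := by
  obtain ⟨N, hN, hN1⟩ := exists_compact_mem_nhds (1 : G)
  have hQ : IsCompact (tsupport β * N ∪ tsupport β) :=
    (β.hasCompactSupport.isCompact.mul hN).union β.hasCompactSupport.isCompact
  obtain ⟨C, hC0, hC⟩ := exists_norm_averageInduced_le α π hQ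
  obtain ⟨U, hU, hUβ⟩ := exists_nhds_one_abs_sub_le β (ε := ε / (C * ‖ξ‖ + 1)) (by positivity)
  refine ⟨U ∩ N, Filter.inter_mem hU hN1, fun φ hφ0 hφU hφ1 => ?_⟩
  rw [← averageInduced_sub]
  refine (hC _ (ε / (C * ‖ξ‖ + 1)) ?_ ?_ ξ).trans ?_
  · exact abs_smear_sub_le hφ0 hφ1 fun g hg =>
      hUβ g (by_contra fun h => hg (hφU g fun h' => h h'.1))
  · intro h hh
    rw [CompactlySupportedContinuousMap.coe_sub, Pi.sub_apply,
      smear_eq_zero (N := N) (fun g hg => hφU g fun h' => hg h'.2) fun h' => hh (Or.inl h'),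
      image_eq_zero_of_notMem_tsupport (f := β) fun h' => hh (Or.inr h'), sub_zero]
  · have h0 : 0 ≤ C * ‖ξ‖ := by positivity
    rw [mul_assoc, div_mul_eq_mul_div, div_le_iff₀ (by positivity)]
    nlinarith

theorem PreInduced.average_translate {E : Type*} [NormedAddCommGroup E]
    [NormedSpace ℂ E] {π : Γ →* (E →L[ℂ] E)} (φ : C_c(G, ℝ)) (g : G) (f : PreInduced α π) :
    average φ (translate g f) = ∫ h : G, (φ (g * h) : ℂ) • f h ∂Measure.haar := by
  rw [average_apply, ← integral_mul_left_eq_self (μ := (Measure.haar : Measure G)) _ g]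
  simp

theorem PreInduced.integral_smul_average_translate (φ β : C_c(G, ℝ)) (f : PreInduced α π) :
    ∫ g : G, reflect β g • average φ (translate g f) ∂Measure.haar =
      average (smear φ β) f := by
  have := α.isMulRightInvariant_haar
  have hφ := map_continuous φ
  have hβ := map_continuous β
  have hf := f.continuous
  simp_rw [average_translate, ← integral_smul]
  rw [integral_integral_swap_of_hasCompactSupport, average_apply]
  · congr 1; ext h
    have e : ∀ g : G, reflect β g • (φ (g * h) : ℂ) • f h =
        ((φ (g * h) * β (h * (g * h)⁻¹) : ℝ) : ℂ) • f h := by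
      intro g
      rw [reflect_apply, smul_smul, ← Complex.ofReal_mul, mul_comm]
      simp
    simp_rw [e]
    rw [integral_smul_const, integral_complex_ofReal, smear_apply,
      integral_mul_right_eq_self (μ := (Measure.haar : Measure G))
        (fun g => φ g * β (h * g⁻¹)) h]
  · have := map_continuous (reflect β)
    unfold Function.uncurry
    fun_prop
  · have hK : IsCompact ((fun z : G × G => (z.1⁻¹, z.1 * z.2)) '' (tsupport β ×ˢ tsupport φ)) :=
      (β.hasCompactSupport.isCompact.prod φ.hasCompactSupport.isCompact).image (by fun_prop)
    refine HasCompactSupport.intro hK ?_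
    rintro ⟨g, h⟩ hgh
    by_contra h0
    have h1 : reflect β g ≠ 0 := left_ne_zero_of_smul h0
    have h2 : (φ (g * h) : ℂ) ≠ 0 := left_ne_zero_of_smul (right_ne_zero_of_smul h0)
    refine hgh ⟨(g⁻¹, g * h), ⟨subset_tsupport _ ?_, subset_tsupport _ ?_⟩, by simp⟩
    · simpa using h1
    · simpa using h2

/-- On an invariant vector, the average only depends on the integral of the weight: this is the
uniqueness of the Haar measure, for a left invariant functional with values in `E`. -/
theorem averageInduced_eq_of_integral_eq
    (hint : ∀ (f : C_c(G, ℂ)) (ξ : InducedSpace α π),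
      Integrable (fun g => f g • inducedHom α π g ξ) (Measure.haar : Measure G))
    (hcont : ∀ f : C_c(G, ℂ), Continuous fun ξ : InducedSpace α π =>
      ∫ g : G, f g • inducedHom α π g ξ ∂Measure.haar)
    {ξ : InducedSpace α π} (hξ : ∀ g, inducedHom α π g ξ = ξ) {β₁ β₂ : C_c(G, ℝ)}
    (hβ : ∫ g : G, reflect β₁ g ∂Measure.haar = ∫ g : G, reflect β₂ g ∂Measure.haar) :
    averageInduced β₁ ξ = averageInduced β₂ ξ := by
  have h0 : ∀ (φ : C_c(G, ℝ)) (f : C_c(G, ℂ)) (η : InducedSpace α π),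
      averageInduced φ (∫ g : G, f g • inducedHom α π g η ∂Measure.haar) =
        ∫ g : G, f g • averageInduced φ (inducedHom α π g η) ∂Measure.haar := by
    intro φ f η
    rw [← (averageInduced φ).integral_comp_comm (hint f η)]
    simp_rw [map_smul]
  have h1 : ∀ (φ β : C_c(G, ℝ)) (η : InducedSpace α π),
      averageInduced φ (∫ g : G, reflect β g • inducedHom α π g η ∂Measure.haar) =
        averageInduced (smear φ β) η := by
    intro φ β η
    refine InducedSpace.induction_on η
      (isClosed_eq ((averageInduced φ).continuous.comp (hcont _)) (by fun_prop)) fun f => ?_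
    rw [h0]
    simp_rw [inducedHom_coe, averageInduced_coe]
    exact f.integral_smul_average_translate φ β
  have key : ∀ φ β : C_c(G, ℝ), averageInduced (smear φ β) ξ =
      (∫ g : G, reflect β g ∂Measure.haar) • averageInduced φ ξ := by
    intro φ β
    rw [← h1, h0]
    simp_rw [hξ]
    exact integral_smul_const _ _
  rw [← sub_eq_zero, ← norm_eq_zero]
  refine le_antisymm (le_of_forall_pos_le_add fun ε hε => ?_) (norm_nonneg _)
  obtain ⟨U₁, hU₁, h₁⟩ := exists_norm_averageInduced_smear_sub_le β₁ ξ (half_pos hε)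
  obtain ⟨U₂, hU₂, h₂⟩ := exists_norm_averageInduced_smear_sub_le β₂ ξ (half_pos hε)
  obtain ⟨φ, hφ0, hφU, hφ1⟩ := exists_approximate_identity (Filter.inter_mem hU₁ hU₂)
  have e₁ := h₁ φ hφ0 (fun g hg => hφU g fun h => hg h.1) hφ1
  have e₂ := h₂ φ hφ0 (fun g hg => hφU g fun h => hg h.2) hφ1
  rw [key, hβ, ← key φ β₂, norm_sub_rev] at e₁
  rw [zero_add]
  have h3 := norm_sub_le_norm_sub_add_norm_sub (averageInduced β₁ ξ)
    (averageInduced (smear φ β₂) ξ) (averageInduced β₂ ξ)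
  linarith

theorem map_averageInduced_of_invariant
    (hint : ∀ (f : C_c(G, ℂ)) (ξ : InducedSpace α π),
      Integrable (fun g => f g • inducedHom α π g ξ) (Measure.haar : Measure G))
    (hcont : ∀ f : C_c(G, ℂ), Continuous fun ξ : InducedSpace α π =>
      ∫ g : G, f g • inducedHom α π g ξ ∂Measure.haar)
    {ξ : InducedSpace α π} (hξ : ∀ g, inducedHom α π g ξ = ξ) (β : C_c(G, ℝ)) (γ : Γ) :
    π γ (averageInduced β ξ) = averageInduced β ξ := by
  rw [map_averageInduced]
  refine averageInduced_eq_of_integral_eq hint hcont hξ ?_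
  rw [← integral_mul_left_eq_self (μ := (Measure.haar : Measure G)) _ (γ : G)]
  simp

/-- On a `Γ`-invariant vector, `spread` yields a constant function. -/
theorem PreInduced.spread_eq_of_invariant {G : Type*} [Group G] [TopologicalSpace G]
    {Γ : Subgroup G} [IsTopologicalGroup G] [LocallyCompactSpace G] [T2Space G]
    [DiscreteTopology Γ] {E : Type*} [NormedAddCommGroup E] [NormedSpace ℂ E]
    {α : CutoffFunction Γ} {π : Γ →* (E →L[ℂ] E)} {x : E} (hx : ∀ γ : Γ, π γ x = x) (h : G) :
    spread α π x h = x := by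
  rw [spread_apply_eq_sum x isCompact_singleton (Set.mem_singleton h)]
  simp_rw [hx]
  rw [← Finset.sum_smul, ← Complex.ofReal_sum, α.sum_translates _ (Set.mem_singleton h)]
  simp

theorem inducedHom_spread_of_invariant {E : Type*} [NormedAddCommGroup E] [NormedSpace ℂ E]
    {π : Γ →* (E →L[ℂ] E)} {x : E} (hx : ∀ γ : Γ, π γ x = x) (g : G) :
    inducedHom α π g (PreInduced.spread α π x : InducedSpace α π) =
      PreInduced.spread α π x := by
  rw [inducedHom_coe]
  congr 1
  refine Subtype.ext (ContinuousMap.ext fun h => ?_)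
  change PreInduced.spread α π x (g⁻¹ * h) = PreInduced.spread α π x h
  rw [PreInduced.spread_eq_of_invariant hx, PreInduced.spread_eq_of_invariant hx]

theorem PreInduced.average_spread_of_invariant {x : E} (hx : ∀ γ : Γ, π γ x = x) :
    average α.toCc (spread α π x) = ((∫ h : G, α h ∂Measure.haar : ℝ) : ℂ) • x := by
  rw [average_apply]
  simp_rw [spread_eq_of_invariant hx]
  rw [integral_smul_const, integral_complex_ofReal]
  rfl

end AverageInduced

/-! ### Compression of operators -/

section DiscreteHaar

variable {H : Type*} [Group H] [TopologicalSpace H] [IsTopologicalGroup H] [LocallyCompactSpace H]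
  [MeasurableSpace H] [BorelSpace H] [DiscreteTopology H]

theorem haar_real_singleton_pos : 0 < (Measure.haar : Measure H).real {1} :=
  ENNReal.toReal_pos ((isOpen_discrete _).measure_pos _ (Set.singleton_nonempty _)).ne'
    isCompact_singleton.measure_lt_top.ne

/-- On a discrete group, the Haar measure is a multiple of the counting measure. -/
theorem integral_haar_eq_smul_finsum {E : Type*} [NormedAddCommGroup E] [NormedSpace ℝ E]
    [CompleteSpace E] {F : H → E} (hF : (Function.support F).Finite) :
    ∫ γ : H, F γ ∂Measure.haar = (Measure.haar : Measure H).real {1} • ∑ᶠ γ : H, F γ := by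
  have hs : ∀ γ : H, (Measure.haar : Measure H).real {γ} = (Measure.haar : Measure H).real {1} := by
    intro γ
    have := measure_preimage_mul (Measure.haar : Measure H) γ⁻¹ {1}
    rw [Measure.real, Measure.real, ← this]
    congr 2; ext x
    simp [eq_comm]
  have hz : ∀ γ ∉ (hF.toFinset : Set H), F γ = 0 := fun γ hγ => by simpa using hγ
  rw [← setIntegral_eq_integral_of_forall_compl_eq_zero hz, setIntegral_finset,
    finsum_eq_sum_of_support_subset (s := hF.toFinset) F (by simp), Finset.smul_sum]
  · simp_rw [hs]
  · exact continuous_of_discreteTopology.continuousOn.integrableOn_compact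
      (Finset.finite_toSet _).isCompact

end DiscreteHaar

section Compression

variable {G : Type*} [Group G] [TopologicalSpace G] {Γ : Subgroup G} [MeasurableSpace G]
  [BorelSpace G] [IsTopologicalGroup G] [LocallyCompactSpace G] [T2Space G] [DiscreteTopology Γ]
  {E : Type*} [NormedAddCommGroup E] [NormedSpace ℂ E] [CompleteSpace E]

/-- The compression of an operator on the induced space to an operator on `E`, by means of the maps
`E → Ind E → E` given by `spread` and `average`; it is normalized so that the identity goes to an
operator fixing the `Γ`-invariant vectors. -/
noncomputable def compress (α : CutoffFunction Γ) (π : Γ →* (E →L[ℂ] E)) :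
    (InducedSpace α π →L[ℂ] InducedSpace α π) →ₗ[ℂ] (E →L[ℂ] E) where
  toFun L := (((∫ h : G, α h ∂Measure.haar)⁻¹ : ℝ) : ℂ) • (averageInduced α.toCc).comp
    (L.comp (InducedSpace.of.toContinuousLinearMap.comp (PreInduced.spreadL α π)))
  map_add' L L' := by ext x; simp
  map_smul' c L := by
    ext x
    simp only [smul_apply, ContinuousLinearMap.comp_apply, map_smul,
      RingHom.id_apply]
    exact smul_comm _ _ _

theorem compress_apply (α : CutoffFunction Γ) (π : Γ →* (E →L[ℂ] E))
    (L : InducedSpace α π →L[ℂ] InducedSpace α π) (x : E) :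
    compress α π L x = (((∫ h : G, α h ∂Measure.haar)⁻¹ : ℝ) : ℂ) •
      averageInduced α.toCc (L (PreInduced.spread α π x : PreInduced α π)) := rfl

variable {α : CutoffFunction Γ} {π : Γ →* (E →L[ℂ] E)}

theorem norm_averageInduced_cutoff_le {M : ℝ} (hM0 : 0 ≤ M)
    (hM : ∀ (y : G) (γ : Γ), α y ≠ 0 → α (1 * y * γ) ≠ 0 → ‖π γ⁻¹‖ ≤ M)
    (ξ : InducedSpace α π) :
    ‖averageInduced α.toCc ξ‖ ≤ M * √(∫ h : G, α h ∂Measure.haar) * ‖ξ‖ := by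
  refine InducedSpace.induction_on ξ (isClosed_le (by fun_prop) (by fun_prop))
    fun f => ?_
  rw [averageInduced_coe, LinearIsometry.norm_map]
  exact ContinuousLinearMap.le_of_opNorm_le _ (PreInduced.norm_average_cutoff_le hM0 hM) f

theorem norm_compress_le {M : ℝ} (hM0 : 0 ≤ M)
    (hM : ∀ (y : G) (γ : Γ), α y ≠ 0 → α (1 * y * γ) ≠ 0 → ‖π γ⁻¹‖ ≤ M)
    (L : InducedSpace α π →L[ℂ] InducedSpace α π) : ‖compress α π L‖ ≤ M ^ 2 * ‖L‖ := by
  have hI := α.integral_pos (Measure.haar : Measure G)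
  refine ContinuousLinearMap.opNorm_le_bound _ (by positivity) fun x => ?_
  rw [compress_apply, norm_smul, Complex.norm_real, norm_inv, Real.norm_of_nonneg hI.le,
    inv_mul_le_iff₀ hI]
  set I := ∫ h : G, α h ∂Measure.haar
  calc ‖averageInduced α.toCc (L (PreInduced.spread α π x : PreInduced α π))‖
      ≤ M * √I * (‖L‖ * (M * √I * ‖x‖)) := by
        refine (norm_averageInduced_cutoff_le hM0 hM _).trans
          (mul_le_mul_of_nonneg_left ?_ (by positivity))
        refine (L.le_opNorm _).trans (mul_le_mul_of_nonneg_left ?_ (norm_nonneg _))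
        rw [LinearIsometry.norm_map]
        exact PreInduced.norm_spread_le hM0 hM x
    _ = √I * √I * (M ^ 2 * ‖L‖ * ‖x‖) := by ring
    _ = _ := by rw [Real.mul_self_sqrt hI.le]

/-- If `P` is an idempotent onto the `G`-invariant vectors of the induced space, its compression
fixes the `Γ`-invariant vectors of `E`. -/
theorem compress_apply_of_invariant {P : InducedSpace α π →L[ℂ] InducedSpace α π}
    (hP : ∀ ξ, (∀ g, inducedHom α π g ξ = ξ) → P ξ = ξ) {x : E} (hx : ∀ γ : Γ, π γ x = x) :
    compress α π P x = x := by
  have hI := α.integral_pos (Measure.haar : Measure G)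
  rw [compress_apply, hP _ (inducedHom_spread_of_invariant hx), averageInduced_coe,
    PreInduced.average_spread_of_invariant hx, smul_smul, ← Complex.ofReal_mul,
    inv_mul_cancel₀ hI.ne', Complex.ofReal_one, one_smul]

theorem integral_mul_coeff_eq_zero (α : CutoffFunction Γ) (f : C_c(G, ℂ)) {γ : Γ}
    (hγ : γ ∉ α.translates (α.isCompact_image2 f.hasCompactSupport.isCompact)) :
    ∫ g : G, f g * (α.coeff γ g : ℂ) ∂Measure.haar = 0 := by
  rw [← integral_zero G ℂ (μ := Measure.haar)]
  congr 1; ext g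
  by_cases hg : g ∈ tsupport f
  · rw [α.coeff_eq_zero f.hasCompactSupport.isCompact hg hγ]
    simp
  · rw [image_eq_zero_of_notMem_tsupport hg, zero_mul]

/-- The map `C_c(G) → C_c(Γ)` which corresponds to the compression of operators: up to a constant,
`γ ↦ ∫ f(g) α.coeff γ g dg`. The factor `haar {1}` accounts for the normalization of the Haar
measure of `Γ`. -/
noncomputable def compressFun (α : CutoffFunction Γ) (f : C_c(G, ℂ)) : C_c(Γ, ℂ) where
  toFun γ := ((((Measure.haar : Measure Γ).real {1})⁻¹ * (∫ h : G, α h ∂Measure.haar)⁻¹ : ℝ) : ℂ) *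
    ∫ g : G, f g * (α.coeff γ g : ℂ) ∂Measure.haar
  continuous_toFun := continuous_of_discreteTopology
  hasCompactSupport' := by
    have hQ := α.isCompact_image2 f.hasCompactSupport.isCompact
    refine HasCompactSupport.intro (α.translates hQ).finite_toSet.isCompact fun γ hγ => ?_
    rw [mul_eq_zero]; right
    exact integral_mul_coeff_eq_zero α f (by simpa using hγ)

theorem compressFun_apply (α : CutoffFunction Γ) (f : C_c(G, ℂ)) (γ : Γ) :
    compressFun α f γ =
      ((((Measure.haar : Measure Γ).real {1})⁻¹ * (∫ h : G, α h ∂Measure.haar)⁻¹ : ℝ) : ℂ) *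
        ∫ g : G, f g * (α.coeff γ g : ℂ) ∂Measure.haar := rfl

theorem support_compressFun_subset (α : CutoffFunction Γ) (f : C_c(G, ℂ)) :
    Function.support (compressFun α f) ⊆
      α.translates (α.isCompact_image2 f.hasCompactSupport.isCompact) := by
  intro γ hγ
  by_contra h
  refine hγ ?_
  rw [compressFun_apply, mul_eq_zero]; right
  exact integral_mul_coeff_eq_zero α f (by simpa using h)

theorem compressFun_star (α : CutoffFunction Γ) (f : C_c(G, ℂ)) :
    compressFun α (star f) = star (compressFun α f) := by
  ext γ
  rw [CompactlySupportedContinuousMap.star_apply, compressFun_apply, compressFun_apply, star_mul',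
    Complex.star_def, Complex.conj_ofReal, ← integral_conj]
  congr 2; ext g
  rw [map_mul, Complex.conj_ofReal]
  rfl

theorem compressFun_of_isInvolutionOf {f f' : C_c(G, ℂ)} (h : IsInvolutionOf f f') (γ : Γ) :
    compressFun α f' γ = (starRingEnd ℂ) (compressFun α f γ⁻¹) := by
  rw [compressFun_apply, compressFun_apply, map_mul, Complex.conj_ofReal, ← integral_conj]
  congr 1
  refine (h ⟨fun g => (α.coeff γ g : ℂ),
    Complex.continuous_ofReal.comp (α.continuous_coeff γ)⟩).trans ?_
  congr 1; ext g
  rw [map_mul, Complex.conj_ofReal, ContinuousMap.coe_mk, ← α.coeff_inv γ, inv_inv]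

/-- The compression commutes with the involutions, by the symmetry of the coefficients. -/
theorem IsInvolutionOf.compressFun {f f' : C_c(G, ℂ)} (h : IsInvolutionOf f f') :
    IsInvolutionOf (compressFun α f) (compressFun α f') := by
  intro φ
  have h1 : (Function.support fun γ : Γ => _root_.compressFun α f' γ * φ γ).Finite :=
    (Finset.finite_toSet _).subset
      ((Function.support_mul_subset_left _ _).trans (support_compressFun_subset α f'))
  have h2 : (Function.support fun γ : Γ =>
      (starRingEnd ℂ) (_root_.compressFun α f γ) * φ γ⁻¹).Finite := by
    refine (Finset.finite_toSet _).subset (fun γ hγ => support_compressFun_subset α f ?_)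
    exact fun h0 => left_ne_zero_of_mul hγ (by rw [h0, map_zero])
  rw [integral_haar_eq_smul_finsum h1, integral_haar_eq_smul_finsum h2]
  congr 1
  rw [← finsum_comp_equiv (Equiv.inv Γ)]
  refine finsum_congr fun γ => ?_
  rw [Equiv.inv_apply, compressFun_of_isInvolutionOf h, inv_inv]

/-- The compression of the operator `π'(f)` on the induced space is `π(f')` with
`f' = compressFun α f`. -/
theorem compress_eq_integral (f : C_c(G, ℂ)) {L : InducedSpace α π →L[ℂ] InducedSpace α π}
    (hint : ∀ ξ, Integrable (fun g => f g • inducedHom α π g ξ) (Measure.haar : Measure G))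
    (hL : ∀ ξ, L ξ = ∫ g : G, f g • inducedHom α π g ξ ∂Measure.haar) (x : E) :
    compress α π L x = ∫ γ : Γ, compressFun α f γ • π γ x ∂Measure.haar := by
  have hQ := f.hasCompactSupport.isCompact
  set S := α.translates (α.isCompact_image2 hQ) with hS
  have hfin : (Function.support fun γ : Γ => compressFun α f γ • π γ x).Finite := by
    refine (Finset.finite_toSet S).subset fun γ hγ => support_compressFun_subset α f ?_
    exact fun h0 => hγ (by simp [h0])
  have h1 : ∀ g, f g • averageInduced α.toCc (inducedHom α π g
      (PreInduced.spread α π x : PreInduced α π)) =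
        ∑ γ ∈ S, (f g * (α.coeff γ g : ℂ)) • π γ x := by
    intro g
    by_cases hg : g ∈ tsupport f
    · rw [inducedHom_coe, averageInduced_coe, PreInduced.average_translate_spread hQ hg,
        Finset.smul_sum]
      simp_rw [smul_smul]
      rfl
    · simp [image_eq_zero_of_notMem_tsupport hg]
  have hfc := map_continuous f
  have h2 : averageInduced α.toCc (L (PreInduced.spread α π x : PreInduced α π)) =
      ∑ γ ∈ S, (∫ g : G, f g * (α.coeff γ g : ℂ) ∂Measure.haar) • π γ x := by
    rw [hL, ← (averageInduced α.toCc).integral_comp_comm (hint _)]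
    simp_rw [map_smul, h1]
    rw [integral_finsetSum]
    · simp_rw [integral_smul_const]
    · intro γ _
      refine Integrable.smul_const (Continuous.integrable_of_hasCompactSupport
        (hfc.mul (Complex.continuous_ofReal.comp (α.continuous_coeff γ)))
        f.hasCompactSupport.mul_right) _
  have hw := haar_real_singleton_pos (H := Γ)
  rw [compress_apply, h2, integral_haar_eq_smul_finsum hfin,
    finsum_eq_sum_of_support_subset (s := S) _ fun γ hγ => support_compressFun_subset α f
      fun h0 => hγ (by simp [h0]), Finset.smul_sum, Finset.smul_sum]
  refine Finset.sum_congr rfl fun γ _ => ?_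
  rw [compressFun_apply, Complex.ofReal_mul, mul_assoc, ← smul_smul _ _ (π γ x),
    ← smul_smul _ _ (π γ x), ← Complex.coe_smul, smul_smul _ _ (_ • _ • π γ x),
    ← Complex.ofReal_mul, mul_inv_cancel₀ hw.ne', Complex.ofReal_one, one_smul]

end Compression

/-! ### The transfer of idempotents -/

/-- A continuous map that maps one graph into another one does so with their closures. -/
theorem mk_mem_closure_of_continuous {X Y : Type*} [TopologicalSpace X] [TopologicalSpace Y]
    {f : X → Y} (hf : Continuous f) {s : Set (X × X)} {t : Set (Y × Y)} {a b : X}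
    (hab : (a, b) ∈ closure s) (hst : ∀ x y, (x, y) ∈ s → (f x, f y) ∈ t) :
    (f a, f b) ∈ closure t :=
  map_mem_closure (f := Prod.map f f) (hf.prodMap hf) hab fun z hz => hst z.1 z.2 hz

section Transfer

variable {G : Type u} [Group G] [TopologicalSpace G] {Γ : Subgroup G} [MeasurableSpace G]
  [BorelSpace G] [IsTopologicalGroup G] [LocallyCompactSpace G] [T2Space G] [DiscreteTopology Γ]
  {𝓔 : Set BanachSp.{max u v}} {m : GroupLength Γ} {m' : GroupLength G} {α : CutoffFunction Γ}
  (hm : LengthDominates α m m') {q T : ℝ} (hq1 : 1 < q) (hq2 : q ≤ 2) (hT : 0 ≤ T)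
  (h𝓔 : 𝓔 ⊆ typeDualTypeClass.{max u v} q T)

/-- The component of a bounded family at an induced representation, as an operator on the induced
space. -/
noncomputable def inducedComponent (p : BoundedFamilies (typeDualTypeClass.{max u v} q T) m')
    (r : BanachRep 𝓔 m) : InducedSpace α r.π →L[ℂ] InducedSpace α r.π :=
  p (BanachRep.induced.{u, v} hm hq1 hq2 hT h𝓔 r)

theorem norm_inducedComponent_le (p : BoundedFamilies (typeDualTypeClass.{max u v} q T) m')
    (r : BanachRep 𝓔 m) : ‖inducedComponent.{u, v} hm hq1 hq2 hT h𝓔 p r‖ ≤ ‖p‖ :=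
  lp.norm_apply_le_norm ENNReal.top_ne_zero p (BanachRep.induced.{u, v} hm hq1 hq2 hT h𝓔 r)

theorem norm_compress_inducedComponent_le
    (p : BoundedFamilies (typeDualTypeClass.{max u v} q T) m') (r : BanachRep 𝓔 m) :
    ‖compress α r.π (inducedComponent.{u, v} hm hq1 hq2 hT h𝓔 p r)‖ ≤ Real.exp (m' 1) ^ 2 * ‖p‖ :=
  (norm_compress_le (Real.exp_nonneg _) (fun _ _ => r.norm_inv_le hm) _).trans
    (mul_le_mul_of_nonneg_left (norm_inducedComponent_le.{u, v} hm hq1 hq2 hT h𝓔 p r)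
      (by positivity))

/-- The map `C_{m'}(G) → C_m(Γ)` obtained from the compressions of the induced representations, on
the level of bounded families of operators. It is not multiplicative. -/
noncomputable def transfer : BoundedFamilies (typeDualTypeClass.{max u v} q T) m' →L[ℂ]
    BoundedFamilies 𝓔 m :=
  LinearMap.mkContinuous
    { toFun := fun p => ⟨fun r => compress α r.π (inducedComponent.{u, v} hm hq1 hq2 hT h𝓔 p r),
        memℓp_infty ⟨Real.exp (m' 1) ^ 2 * ‖p‖, by
          rintro _ ⟨r, rfl⟩
          exact norm_compress_inducedComponent_le.{u, v} hm hq1 hq2 hT h𝓔 p r⟩⟩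
      map_add' := fun p p' => Subtype.ext <| funext fun r =>
        (compress α r.π).map_add (inducedComponent.{u, v} hm hq1 hq2 hT h𝓔 p r)
          (inducedComponent.{u, v} hm hq1 hq2 hT h𝓔 p' r)
      map_smul' := fun c p => Subtype.ext <| funext fun r =>
        (compress α r.π).map_smul c (inducedComponent.{u, v} hm hq1 hq2 hT h𝓔 p r) }
    (Real.exp (m' 1) ^ 2)
    fun p => lp.norm_le_of_forall_le (by positivity)
      (norm_compress_inducedComponent_le.{u, v} hm hq1 hq2 hT h𝓔 p)

theorem transfer_apply (p : BoundedFamilies (typeDualTypeClass.{max u v} q T) m')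
    (r : BanachRep 𝓔 m) : (transfer.{u, v} hm hq1 hq2 hT h𝓔 p) r =
      compress α r.π (inducedComponent.{u, v} hm hq1 hq2 hT h𝓔 p r) := rfl

theorem inducedComponent_integratedFamily (f : C_c(G, ℂ)) (r : BanachRep 𝓔 m)
    (ξ : InducedSpace α r.π) :
    inducedComponent.{u, v} hm hq1 hq2 hT h𝓔 (integratedFamily _ _ f) r ξ =
      ∫ g, f g • inducedHom α r.π g ξ ∂Measure.haar :=
  rfl

theorem transfer_integratedFamily_apply (f : C_c(G, ℂ)) (r : BanachRep 𝓔 m) (x : r.E) :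
    (transfer.{u, v} hm hq1 hq2 hT h𝓔 (integratedFamily _ _ f)) r x =
      ∫ γ : Γ, compressFun α f γ • r.π γ x ∂Measure.haar := by
  rw [transfer_apply]
  exact compress_eq_integral f
    (fun ξ => (BanachRep.induced.{u, v} hm hq1 hq2 hT h𝓔 r).integrable_smul f ξ)
    (inducedComponent_integratedFamily.{u, v} hm hq1 hq2 hT h𝓔 f r) x

theorem transfer_integratedFamily (f : C_c(G, ℂ)) :
    transfer.{u, v} hm hq1 hq2 hT h𝓔 (integratedFamily _ _ f) =
      integratedFamily 𝓔 m (compressFun α f) :=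
  Subtype.ext <| funext fun r => ContinuousLinearMap.ext fun x =>
    transfer_integratedFamily_apply.{u, v} hm hq1 hq2 hT h𝓔 f r x

theorem transfer_mem_completedAlgebra {p : BoundedFamilies (typeDualTypeClass.{max u v} q T) m'}
    (hp : p ∈ completedAlgebra (typeDualTypeClass.{max u v} q T) m') :
    transfer.{u, v} hm hq1 hq2 hT h𝓔 p ∈ completedAlgebra 𝓔 m := by
  refine map_mem_closure (transfer.{u, v} hm hq1 hq2 hT h𝓔).continuous hp ?_
  rintro _ ⟨f, rfl⟩
  exact ⟨compressFun α f, (transfer_integratedFamily.{u, v} hm hq1 hq2 hT h𝓔 f).symm⟩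

theorem IsRealElement.transfer {p : BoundedFamilies (typeDualTypeClass.{max u v} q T) m'}
    (hp : IsRealElement p) : IsRealElement (transfer.{u, v} hm hq1 hq2 hT h𝓔 p) := by
  refine mk_mem_closure_of_continuous (_root_.transfer.{u, v} hm hq1 hq2 hT h𝓔).continuous hp ?_
  rintro _ _ ⟨f, hf⟩
  obtain ⟨rfl, rfl⟩ := Prod.mk.inj hf
  refine ⟨compressFun α f, ?_⟩
  rw [← compressFun_star, transfer_integratedFamily, transfer_integratedFamily]

theorem IsSelfAdjointElement.transfer
    {p : BoundedFamilies (typeDualTypeClass.{max u v} q T) m'}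
    (hp : IsSelfAdjointElement p) :
    IsSelfAdjointElement (transfer.{u, v} hm hq1 hq2 hT h𝓔 p) := by
  refine mk_mem_closure_of_continuous (_root_.transfer.{u, v} hm hq1 hq2 hT h𝓔).continuous hp ?_
  rintro _ _ ⟨f, f', hff', hf⟩
  obtain ⟨rfl, rfl⟩ := Prod.mk.inj hf
  refine ⟨compressFun α f, compressFun α f', hff'.compressFun, ?_⟩
  rw [transfer_integratedFamily, transfer_integratedFamily]

section Idempotent

variable {p : BoundedFamilies (typeDualTypeClass.{max u v} q T) m'} (hp : IsIdempotentElem p)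
  (hrange : ∀ R : BanachRep (typeDualTypeClass.{max u v} q T) m',
    Set.range (p R : R.E →L[ℂ] R.E) = {x : R.E | ∀ g : G, R.π g x = x}) (r : BanachRep 𝓔 m)

include hp hrange in
theorem inducedComponent_apply_of_invariant (ξ : InducedSpace α r.π)
    (hξ : ∀ g, inducedHom α r.π g ξ = ξ) : inducedComponent.{u, v} hm hq1 hq2 hT h𝓔 p r ξ = ξ := by
  have h1 : ξ ∈ Set.range (inducedComponent.{u, v} hm hq1 hq2 hT h𝓔 p r) :=
    (hrange (BanachRep.induced.{u, v} hm hq1 hq2 hT h𝓔 r)).ge hξ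
  obtain ⟨η, rfl⟩ := h1
  have h2 : p (BanachRep.induced.{u, v} hm hq1 hq2 hT h𝓔 r) *
      p (BanachRep.induced.{u, v} hm hq1 hq2 hT h𝓔 r) =
        p (BanachRep.induced.{u, v} hm hq1 hq2 hT h𝓔 r) :=
    congrFun (congrArg Subtype.val hp.eq) _
  exact DFunLike.congr_fun h2 η

include hp hrange in
theorem transfer_apply_of_invariant {x : r.E} (hx : ∀ γ : Γ, r.π γ x = x) :
    (transfer.{u, v} hm hq1 hq2 hT h𝓔 p) r x = x :=
  compress_apply_of_invariant
    (inducedComponent_apply_of_invariant hm hq1 hq2 hT h𝓔 hp hrange r) hx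

include hrange in
theorem map_transfer_apply (x : r.E) (γ : Γ) :
    r.π γ ((transfer.{u, v} hm hq1 hq2 hT h𝓔 p) r x) =
      (transfer.{u, v} hm hq1 hq2 hT h𝓔 p) r x := by
  rw [transfer_apply, compress_apply, map_smul]
  congr 1
  refine map_averageInduced_of_invariant
    (fun f ξ => (BanachRep.induced.{u, v} hm hq1 hq2 hT h𝓔 r).integrable_smul f ξ)
    (fun f => ((BanachRep.induced.{u, v} hm hq1 hq2 hT h𝓔 r).integrated f).continuous) ?_ _ γ
  exact (hrange (BanachRep.induced.{u, v} hm hq1 hq2 hT h𝓔 r)).le ⟨_, rfl⟩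

include hp hrange in
theorem range_transfer : Set.range ((transfer.{u, v} hm hq1 hq2 hT h𝓔 p) r : r.E →L[ℂ] r.E) =
    {x : r.E | ∀ γ : Γ, r.π γ x = x} := by
  refine Set.Subset.antisymm ?_ fun x hx =>
    ⟨x, transfer_apply_of_invariant hm hq1 hq2 hT h𝓔 hp hrange r hx⟩
  rintro _ ⟨x, rfl⟩
  exact map_transfer_apply hm hq1 hq2 hT h𝓔 hrange r x

include hp hrange in
theorem isIdempotentElem_transfer : IsIdempotentElem (transfer.{u, v} hm hq1 hq2 hT h𝓔 p) := by
  refine Subtype.ext (funext fun r => ContinuousLinearMap.ext fun x => ?_)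
  exact transfer_apply_of_invariant hm hq1 hq2 hT h𝓔 hp hrange r
    (map_transfer_apply hm hq1 hq2 hT h𝓔 hrange r x)

end Idempotent

end Transfer

theorem proposition5p5 {G : Type u} [Group G] [TopologicalSpace G] [IsTopologicalGroup G]
    [LocallyCompactSpace G] [T2Space G] [MeasurableSpace G] [BorelSpace G]
    (Γ : Subgroup G) [DiscreteTopology Γ] [CompactSpace (G ⧸ Γ)]
    (hG : StrongBanachPropertyT.{u, max u v} G) :
    StrongBanachPropertyT.{u, max u v} Γ := by
  intro 𝓔 htype hdual _ ℓ
  obtain ⟨q, T, hq1, hq2, hT, h𝓔⟩ := htype.exists_subset_typeDualTypeClass hdual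
  obtain ⟨α⟩ := exists_cutoffFunction Γ
  obtain ⟨b, hb⟩ := α.exists_le_inducedLength ℓ
  obtain ⟨s₀, hs₀, h⟩ := hG (typeDualTypeClass q T) (isOfTypeGTOne_typeDualTypeClass hq1 hT)
    (stableUnderDuality_typeDualTypeClass hq1 hT) stableUnderConj_typeDualTypeClass
    (α.inducedLength ℓ)
  refine ⟨s₀, hs₀, fun C s hs hss₀ => ?_⟩
  -- the additive constant `b` in the comparison of the lengths is absorbed into `C`
  obtain ⟨p, hpmem, hp, hpreal, hpsa, hrange⟩ := h (C + s * b) s hs hss₀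
  have hm : LengthDominates α (ℓ.affine C s) ((α.inducedLength ℓ).affine (C + s * b) s) := by
    intro g y γ hy hγ
    change C + s * ℓ γ ≤ C + s * b + s * α.inducedLength ℓ g
    calc C + s * ℓ γ ≤ C + s * (α.inducedLength ℓ g + b) := by gcongr; exact hb g y γ hy hγ
      _ = _ := by ring
  exact ⟨transfer.{u, v} hm hq1 hq2 hT h𝓔 p, transfer_mem_completedAlgebra hm hq1 hq2 hT h𝓔 hpmem,
    isIdempotentElem_transfer hm hq1 hq2 hT h𝓔 hp hrange, hpreal.transfer.{u, v} hm hq1 hq2 hT h𝓔,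
    hpsa.transfer.{u, v} hm hq1 hq2 hT h𝓔, range_transfer hm hq1 hq2 hT h𝓔 hp hrange⟩
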